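/- Let $n\ge 2$ and let $p$ be a real polynomial of exact degree $n$ with $n$ distinct real zeros, with leading coefficient $\mathrm{LC}(p)$ and local extrema $y_1<\dots<y_{n-1}$. Put $$\zeta(p)=\min_{1\le k\le n-1}|p(y_k)|>0,\qquad c_p=\Big(\frac{2|\mathrm{LC}(p)|}{\zeta(p)}\Big)^{1/n},$$ let $T_n$ be the Chebyshev polynomial of the first kind, $T_n(\cos t)=\cos(nt)$, and let $\sigma\in\{1,-1\}$ be the sign of $\mathrm{LC}(p)$. For a real polynomial $q$ of degree $n$ with $n$ distinct real zeros and for $-\zeta(q)\le a<b\le\zeta(q)$, the set $\{x\in\mathbb R: a\le q(x)\le b\}$ is the union of $n$ closed intervals (bands), one in each of the $n$ closed intervals into which the local extrema of $q$ divide the real line; two bands can meet only at an endpoint. Denote by $B_j[q](a,b)$, $1\le j\le n$, the $j$-th band counted from right to left, and by $|\cdot|$ Lebesgue measure. **Theorem 6.4.** For all $-\zeta(p)\le a<b\le\zeta(p)$ and all $1\le j\le n$, $$\big|B_j[p](a,b)\big|\le\Big|B_j\big[\sigma\,T_n(c_p x/2)\big]\Big(\frac{a}{\zeta(p)},\frac{b}{\zeta(p)}\Big)\Big|.$$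 In particular, if $\mathrm{LC}(p)>0$, the comparison polynomial is $T_n(c_p x/2)$ with $c_p=(2\,\mathrm{LC}(p)/\zeta(p))^{1/n}$. -/

import Mathlib

/-- Real polynomials of exact degree `n` with `n` distinct real zeros. -/
def IsRealRooted (n : ℕ) (p : Polynomial ℝ) : Prop :=
  p.degree = (n : WithBot ℕ) ∧ p.roots.toFinset.card = n

/-- The points at which `p`, as a function on the real line, has a local extremum. -/
def extremaSet (p : Polynomial ℝ) : Set ℝ :=
  {y : ℝ | IsLocalExtr (fun x : ℝ => p.eval x) y}

/-- The least value of `|p|` at the local extrema of `p`. (A real-rooted `p` of degree `n ≥ 2` has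
exactly `n - 1` local extrema, so that the infimum is a minimum over a finite nonempty set.) -/
noncomputable def zetaMin (p : Polynomial ℝ) : ℝ :=
  sInf ((fun y : ℝ => |p.eval y|) '' extremaSet p)

/-- The `j`-th of the closed intervals into which the local extrema of `p` divide the real line,
counted from right to left starting with `j = 1`: at most `j - 1` extrema lie strictly to the right
of `x`, and at least `j - 1` extrema lie at `x` or to its right. -/
def lap (p : Polynomial ℝ) (j : ℕ) : Set ℝ :=
  {x : ℝ | (extremaSet p ∩ Set.Ioi x).ncard < j ∧ j ≤ (extremaSet p ∩ Set.Ici x).ncard + 1}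

/-- The `j`-th band of `{x | a ≤ p x ≤ b}`, counted from right to left. For levels
`-zetaMin p ≤ a < b ≤ zetaMin p` every lap contains exactly one band; two bands can touch
only at an endpoint, which is then an extremum of `p`. -/
def band (p : Polynomial ℝ) (j : ℕ) (a b : ℝ) : Set ℝ :=
  {x : ℝ | x ∈ lap p j ∧ a ≤ p.eval x ∧ p.eval x ≤ b}

/-- The scaling factor `c_p = (2 |LC(p)| / ζ(p)) ^ (1 / n)`. -/
noncomputable def scaleFactor (n : ℕ) (p : Polynomial ℝ) : ℝ :=
  (2 * |p.leadingCoeff| / zetaMin p) ^ (1 / (n : ℝ))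

/-- The polynomial `T_n (c x / 2)`, with `T_n` the Chebyshev polynomial of the first kind. -/
noncomputable def rescaledChebyshev (n : ℕ) (c : ℝ) : Polynomial ℝ :=
  (Polynomial.Chebyshev.T ℝ (n : ℤ)).comp (Polynomial.C (c / 2) * Polynomial.X)

/-!
After multiplication by `σ / ζ` and a dilation of the line, `p` becomes a polynomial `P` of degree
`n` with the leading coefficient `2 ^ (n - 1)` of `T_n`, which takes values `≥ 1` and `≤ -1` in turn
at its extrema. Dropping the requirement that these points be critical, call `P` alternating
(`Alternates`) if it takes such values at `n + 1` points `y 0 > ⋯ > y n`. It then has one simple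
zero between any two neighbouring points, and it is strictly monotone there as long as its values
lie in `(-1, 1)`; otherwise some `P - c` would alternate in sign at too many points
(`not_alternating_of_degree_lt`, a consequence of Lagrange interpolation). For levels inside
`(-1, 1)`, a band in the lap `[y (i + 1), y i]` is thus the longest segment `[u, v]` of the lap for
which `(-1) ^ i * P` is at least the lower level at `u` and at most the upper level at `v`
(`IsSegment`).

The theorem says that the longest segment, over all alternating polynomials, occurs for `T_n`.

* A longest segment exists (`IsSegment.exists_longest`). As `|P| ≤ 1` on a segment `[u, v]`, a
  segment of length at least `ℓ` confines the zeros of `P` to a bounded distance from `u`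
  (`abs_sub_le_of_prod_le_one`). Up to a translation only a compact set of configurations remains.
* For a longest segment every inner value `P (y k)` is `± 1` (`IsSegment.eval_eq_one_of_longest`).
  If one of them were larger in modulus, one could add to `P` a small multiple of a polynomial of
  degree `n - 1` which vanishes at all other inner points and at one point of `(u, v)`. With the
  right sign this lengthens the segment and keeps `P` alternating. Moving `y k`, one sees that it
  has to be a critical point as well (`IsSegment.derivative_eval_eq_zero_of_longest`).
* An alternating polynomial all of whose critical values are `± 1` is a translate of `T_n`
  (`Alternates.exists_eq_chebyshev`), by the extremal property of the leading coefficient of `T_n`.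

Levels `± ζ` are attained only at finitely many points, so that they do not affect the length of a
band, and a subset of the line has at most the measure of its diameter.
-/

open Polynomial Topology

/-! ### Zeros, critical points and sign changes of polynomials -/

theorem eq_C_mul_prod_of_eval_eq_zero {n : ℕ} {P : ℝ[X]} {a : ℝ} (hP : P.natDegree ≤ n)
    (ha : P.coeff n = a) {z : ℕ → ℝ} (hz : Set.InjOn z (Finset.range n))
    (h0 : ∀ i < n, P.eval (z i) = 0) : P = C a * ∏ i ∈ Finset.range n, (X - C (z i)) := by
  set M : ℝ[X] := ∏ i ∈ Finset.range n, (X - C (z i)) with hM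
  have hMm : M.Monic := monic_prod_of_monic _ _ fun i _ => monic_X_sub_C _
  have hMd : M.natDegree = n := by
    rw [hM, natDegree_prod_of_monic _ _ fun i _ => monic_X_sub_C _]; simp
  rw [← sub_eq_zero]
  refine eq_zero_of_degree_lt_of_eval_finset_eq_zero ((Finset.range n).image z) ?_ ?_
  · rw [Finset.card_image_of_injOn hz, Finset.card_range, degree_lt_iff_coeff_zero]
    intro k hk
    rcases hk.eq_or_lt with rfl | hk
    · have : M.coeff n = 1 := by
        have := hMm.coeff_natDegree; rwa [hMd] at this
      rw [coeff_sub, coeff_C_mul, this, ha, mul_one, sub_self]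
    · rw [coeff_sub, coeff_C_mul, coeff_eq_zero_of_natDegree_lt (hP.trans_lt hk),
        coeff_eq_zero_of_natDegree_lt (hMd.trans_lt hk), mul_zero, sub_self]
  · intro x hx
    obtain ⟨i, hi, rfl⟩ := Finset.mem_image.mp hx
    have h2 : M.eval (z i) = 0 := by
      rw [hM, eval_prod]; exact Finset.prod_eq_zero hi (by simp)
    simp [h0 i (Finset.mem_range.mp hi), h2]

/-- A polynomial of degree `n ≥ 1` has no critical points besides any `n - 1` given ones. -/
theorem exists_eq_of_derivative_eval_eq_zero {n : ℕ} (hn : 1 ≤ n) {P : ℝ[X]}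
    (hP : P.natDegree ≤ n) (hP0 : P.coeff n ≠ 0) {y : ℕ → ℝ} (hy : Set.InjOn y (Set.Ioo 0 n))
    (hcrit : ∀ k, 0 < k → k < n → P.derivative.eval (y k) = 0) {x : ℝ}
    (hx : P.derivative.eval x = 0) : ∃ k, 0 < k ∧ k < n ∧ x = y k := by
  by_contra! hex
  have hnot : x ∉ (Finset.Ioo 0 n).image y := by
    intro hmem
    obtain ⟨k, hk, hkx⟩ := Finset.mem_image.mp hmem
    exact hex k (Finset.mem_Ioo.mp hk).1 (Finset.mem_Ioo.mp hk).2 hkx.symm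
  have hzero : P.derivative = 0 := by
    refine eq_zero_of_natDegree_lt_card_of_eval_eq_zero' _ (insert x ((Finset.Ioo 0 n).image y))
      ?_ ?_
    · intro r hr
      rcases Finset.mem_insert.mp hr with rfl | hr
      · exact hx
      · obtain ⟨k, hk, rfl⟩ := Finset.mem_image.mp hr
        exact hcrit k (Finset.mem_Ioo.mp hk).1 (Finset.mem_Ioo.mp hk).2
    · rw [Finset.card_insert_of_notMem hnot,
        Finset.card_image_of_injOn (by rwa [Finset.coe_Ioo]), Nat.card_Ioo]
      have := natDegree_derivative_le P
      omega
  have hc := coeff_derivative P (n - 1)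
  rw [hzero, coeff_zero, Nat.sub_add_cancel hn] at hc
  rcases mul_eq_zero.mp hc.symm with h | h
  · exact hP0 h
  · have : (0 : ℝ) < ((n - 1 : ℕ) : ℝ) + 1 := by positivity
    linarith

theorem zero_lt_neg_one_pow_mul_prod_sub {m k : ℕ} {v : ℕ → ℝ} (hv : StrictAntiOn v (Set.Iic m))
    (hk : k ≤ m) :
    0 < (-1) ^ k * ∏ l ∈ (Finset.range (m + 1)).erase k, (v k - v l) := by
  have h₁ : 0 < ∏ l ∈ Finset.range k, ((-1) * (v k - v l)) := by
    refine Finset.prod_pos fun l hl => ?_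
    have hl := Finset.mem_range.mp hl
    have := hv (a := l) (b := k) (by simp; omega) (by simpa using hk) hl
    linarith
  rw [Finset.prod_mul_distrib, Finset.prod_const, Finset.card_range] at h₁
  have h₂ : 0 < ∏ l ∈ Finset.Ioc k m, (v k - v l) := by
    refine Finset.prod_pos fun l hl => ?_
    have hl := Finset.mem_Ioc.mp hl
    have := hv (a := k) (b := l) (by simpa using hk) (by simpa using hl.2) hl.1
    linarith
  have union : (Finset.range (m + 1)).erase k = Finset.range k ∪ Finset.Ioc k m := by grind
  have disjoint : Disjoint (Finset.range k) (Finset.Ioc k m) := by grind [Finset.disjoint_iff_ne]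
  rw [union, Finset.prod_union disjoint, ← mul_assoc]
  exact mul_pos h₁ h₂

/-- A polynomial of degree less than `m` cannot alternate in sign along `m + 1` points: the
interpolation formula for its vanishing coefficient of order `m` would be a sum of nonnegative
terms, the first of which is positive. -/
theorem not_alternating_of_degree_lt {m : ℕ} {q : ℝ[X]} (hq : q.degree < m) {v : ℕ → ℝ}
    (hv : ∀ k < m, v (k + 1) < v k) (h : ∀ k ≤ m, 0 ≤ (-1) ^ k * q.eval (v k))
    (h0 : 0 < q.eval (v 0)) : False := by
  have hv := strictAntiOn_Iic_of_succ_lt hv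
  have hinj : Set.InjOn v (Finset.range (m + 1)) := by
    intro a ha b hb hab
    exact hv.injOn (by simp at ha ⊢; omega) (by simp at hb ⊢; omega) hab
  have hsum := Lagrange.coeff_eq_sum (s := Finset.range (m + 1)) hinj (P := q) (by
    simp only [Finset.card_range]; exact hq.trans (by exact_mod_cast Nat.lt_succ_self m))
  simp only [Finset.card_range, Nat.add_sub_cancel] at hsum
  rw [coeff_eq_zero_of_degree_lt hq] at hsum
  refine hsum.not_lt (Finset.sum_pos' (fun k hk => ?_) ⟨0, by simp, ?_⟩)
  · have hk : k ≤ m := by simp at hk; omega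
    have h1 := zero_lt_neg_one_pow_mul_prod_sub hv hk
    have h2 := h k hk
    rw [← mul_div_mul_left _ _ (pow_ne_zero k (by norm_num : (-1 : ℝ) ≠ 0))]
    positivity
  · have h1 := zero_lt_neg_one_pow_mul_prod_sub hv (Nat.zero_le m)
    rw [pow_zero, one_mul] at h1
    positivity

/-! ### Alternating polynomials -/

/-- The normalised polynomials: `P` has degree `n` and the leading coefficient `2 ^ (n - 1)` of the
Chebyshev polynomial, and takes values `≥ 1` and `≤ -1` in turn at `n + 1` points
`y 0 > y 1 > ⋯ > y n`. These points need not be critical points of `P`. The values of `y` beyond `n`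
are irrelevant. -/
structure Alternates (n : ℕ) (P : ℝ[X]) (y : ℕ → ℝ) : Prop where
  natDegree_le : P.natDegree ≤ n
  coeff_eq : P.coeff n = 2 ^ (n - 1)
  succ_lt : ∀ k < n, y (k + 1) < y k
  one_le : ∀ k ≤ n, 1 ≤ (-1) ^ k * P.eval (y k)

namespace Alternates

variable {n : ℕ} {P : ℝ[X]} {y : ℕ → ℝ}

theorem strictAntiOn (h : Alternates n P y) : StrictAntiOn y (Set.Iic n) :=
  strictAntiOn_Iic_of_succ_lt h.succ_lt

/-- Between two neighbouring points `y (i + 1) < y i` the polynomial increases (or decreases,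
according to the parity of `i`) as long as its values lie in `(-1, 1)`: otherwise `P - c` would
alternate in sign along `n + 3` points. -/
theorem not_le_eval_of_lt (h : Alternates n P y) {i : ℕ} (hi : i < n) {t x c : ℝ}
    (ht : y (i + 1) < t) (htx : t < x) (hx : x < y i) (hc1 : -1 < c) (hc2 : c < 1)
    (h1 : c ≤ (-1) ^ i * P.eval t) (h2 : (-1) ^ i * P.eval x ≤ c) : False := by
  set s : ℝ := (-1) ^ i with hs
  have hss : s * s = 1 := by rw [hs, ← mul_pow]; norm_num
  have hsc : |s * c| < 1 := by
    rw [abs_mul, hs, abs_neg_one_pow, one_mul, abs_lt]; exact ⟨hc1, hc2⟩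
  -- `x` and `t` are inserted between `y i` and `y (i + 1)`.
  let v : ℕ → ℝ := fun l => if l ≤ i then y l else if l = i + 1 then x else
    if l = i + 2 then t else y (l - 2)
  have hdeg : (P - C (s * c)).degree < ((n + 2 : ℕ) : WithBot ℕ) := by
    have : (P - C (s * c)).natDegree ≤ n := by
      rw [natDegree_sub_C]; exact h.natDegree_le
    exact (degree_le_of_natDegree_le this).trans_lt (by exact_mod_cast (by omega : n < n + 2))
  have key : ∀ k ≤ n, 0 < (-1) ^ k * (P - C (s * c)).eval (y k) := by
    intro k hk
    have h3 := h.one_le k hk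
    have h4 : (-1) ^ k * (s * c) ≤ |s * c| := by
      refine (le_abs_self _).trans ?_
      rw [abs_mul, abs_neg_one_pow, one_mul]
    rw [eval_sub, eval_C, mul_sub]
    linarith
  refine not_alternating_of_degree_lt hdeg (v := v) (fun k hk => ?_) (fun k hk => ?_) ?_
  · rcases lt_trichotomy k i with hki | rfl | hki
    · have := h.succ_lt k (by omega)
      simpa [v, hki.le, hki, Nat.succ_le_of_lt hki] using this
    · simpa [v] using hx
    · rcases Nat.lt_or_ge k (i + 3) with h3 | h3
      · obtain rfl | rfl : k = i + 1 ∨ k = i + 2 := by omega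
        · simpa [v] using htx
        · simpa [v] using ht
      · have := h.succ_lt (k - 2) (by omega)
        have e : k - 2 + 1 = k + 1 - 2 := by omega
        rw [e] at this
        simp only [v]
        rw [if_neg (by omega), if_neg (by omega), if_neg (by omega), if_neg (by omega),
          if_neg (by omega), if_neg (by omega)]
        exact this
  · rcases Nat.lt_or_ge i k with hki | hki
    · rcases Nat.lt_or_ge k (i + 3) with h3 | h3
      · obtain rfl | rfl : k = i + 1 ∨ k = i + 2 := by omega
        · simp only [v, pow_succ, ← hs]
          rw [if_neg (by omega), if_pos trivial, eval_sub, eval_C]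
          nlinarith
        · simp only [v, pow_succ, ← hs]
          rw [if_neg (by omega), if_neg (by omega), if_pos trivial, eval_sub, eval_C]
          nlinarith
      · have := (key (k - 2) (by omega)).le
        have e : (-1 : ℝ) ^ k = (-1) ^ (k - 2) := by
          obtain ⟨m, rfl⟩ : ∃ m, k = m + 2 := ⟨k - 2, by omega⟩
          simp [pow_succ]
        simp only [v]
        rw [if_neg (by omega), if_neg (by omega), if_neg (by omega), e]
        exact this
    · simpa [v, hki] using (key k (by omega)).le
  · simpa [v] using key 0 (by omega)

theorem eval_succ_le (h : Alternates n P y) {i : ℕ} (hi : i < n) :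
    (-1) ^ i * P.eval (y (i + 1)) ≤ -1 := by
  have := h.one_le (i + 1) hi
  rw [pow_succ] at this
  linarith

/-- By the intermediate value theorem, all zeros are real and simple, one between any two
neighbouring alternation points. -/
theorem exists_eq_prod (h : Alternates n P y) :
    ∃ z : ℕ → ℝ, (∀ i < n, y (i + 1) < z i ∧ z i < y i) ∧
      P = C (2 ^ (n - 1)) * ∏ i ∈ Finset.range n, (X - C (z i)) := by
  have hroot : ∀ i, ∃ z, i < n → (y (i + 1) < z ∧ z < y i) ∧ P.eval z = 0 := by
    intro i
    by_cases hi : i < n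
    · have h1 := h.eval_succ_le hi
      have h2 := h.one_le i hi.le
      have hc : ContinuousOn (fun t => (-1) ^ i * P.eval t) (Set.Icc (y (i + 1)) (y i)) :=
        (continuous_const.mul P.continuous).continuousOn
      obtain ⟨z, hz, hz0⟩ := intermediate_value_Ioo (h.succ_lt i hi).le hc
        (show (0 : ℝ) ∈ Set.Ioo _ _ from ⟨by linarith, by linarith⟩)
      refine ⟨z, fun _ => ⟨hz, ?_⟩⟩
      simpa using hz0
    · exact ⟨0, fun h => absurd h hi⟩
  choose z hz using hroot
  refine ⟨z, fun i hi => (hz i hi).1, ?_⟩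
  have hzlt : ∀ i j, i < j → j < n → z j < z i := by
    intro i j hij hj
    have h1 := (hz i (by omega)).1.1
    have h2 := (hz j hj).1.2
    have h3 := h.strictAntiOn.antitoneOn (a := i + 1) (b := j) (by simp; omega) (by simp; omega) hij
    linarith
  have hinj : Set.InjOn z (Finset.range n) := by
    intro i hi j hj hij
    simp only [Finset.coe_range, Set.mem_Iio] at hi hj
    rcases lt_trichotomy i j with hlt | rfl | hlt
    · exact absurd hij (hzlt i j hlt hj).ne'
    · rfl
    · exact absurd hij (hzlt j i hlt hi).ne
  exact eq_C_mul_prod_of_eval_eq_zero h.natDegree_le h.coeff_eq hinj fun i hi => (hz i hi).2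

theorem lt_of_index_lt (h : Alternates n P y) {a b : ℕ} (hab : a < b) (hb : b ≤ n) : y b < y a :=
  h.strictAntiOn (by simp; omega) (by simpa using hb) hab

theorem le_of_index_le (h : Alternates n P y) {a b : ℕ} (hab : a ≤ b) (hb : b ≤ n) : y b ≤ y a :=
  h.strictAntiOn.antitoneOn (by simp; omega) (by simpa using hb) hab

theorem neg_one_pow_mul_prod_interior_pos (h : Alternates n P y) {i : ℕ} (hi : i < n) {x : ℝ}
    (hx : x ∈ Set.Ioo (y (i + 1)) (y i)) :
    0 < (-1) ^ i * ∏ l ∈ Finset.Ioo 0 n, (x - y l) := by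
  have h₁ : 0 < ∏ l ∈ Finset.Ioc 0 i, ((-1) * (x - y l)) := by
    refine Finset.prod_pos fun l hl => ?_
    have := h.le_of_index_le (Finset.mem_Ioc.mp hl).2 hi.le
    linarith [hx.2]
  rw [Finset.prod_mul_distrib, Finset.prod_const, Nat.card_Ioc, Nat.sub_zero] at h₁
  have h₂ : 0 < ∏ l ∈ Finset.Ioo i n, (x - y l) := by
    refine Finset.prod_pos fun l hl => ?_
    have hl := Finset.mem_Ioo.mp hl
    have := h.le_of_index_le (Nat.succ_le_of_lt hl.1) hl.2.le
    linarith [hx.1]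
  have union : Finset.Ioo 0 n = Finset.Ioc 0 i ∪ Finset.Ioo i n := by grind
  have disjoint : Disjoint (Finset.Ioc 0 i) (Finset.Ioo i n) := by grind [Finset.disjoint_iff_ne]
  rw [union, Finset.prod_union disjoint, ← mul_assoc]
  exact mul_pos h₁ h₂

end Alternates

/-! ### Segments in a lap -/

/-- A candidate for a band in the `i`-th lap (numbered from `0`, from right to left) of an
alternating polynomial `P`: the points `u ≤ v` lie in the lap, and `(-1) ^ i * P`, which is at most
`-1` at the left and at least `1` at the right end of the lap, is at least `α` at `u` and at most
`β` at `v`. -/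
structure IsSegment (n : ℕ) (P : ℝ[X]) (y : ℕ → ℝ) (i : ℕ) (α β u v : ℝ) : Prop where
  alternates : Alternates n P y
  le_left : y (i + 1) ≤ u
  le : u ≤ v
  right_le : v ≤ y i
  le_eval : α ≤ (-1) ^ i * P.eval u
  eval_le : (-1) ^ i * P.eval v ≤ β

namespace IsSegment

variable {n i : ℕ} {P : ℝ[X]} {y : ℕ → ℝ} {α β u v : ℝ}

theorem lt_left (h : IsSegment n P y i α β u v) (hi : i < n) (hα : -1 < α) : y (i + 1) < u := by
  refine lt_of_le_of_ne h.le_left ?_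
  rintro rfl
  have := h.alternates.eval_succ_le hi
  have := h.le_eval
  linarith

theorem right_lt (h : IsSegment n P y i α β u v) (hi : i < n) (hβ : β < 1) : v < y i := by
  refine lt_of_le_of_ne h.right_le ?_
  rintro rfl
  have := h.alternates.one_le i hi.le
  have := h.eval_le
  linarith

theorem eval_mem_Icc (h : IsSegment n P y i α β u v) (hi : i < n) (hα : -1 < α) (hαβ : α ≤ β)
    (hβ : β < 1) {t : ℝ} (ht : t ∈ Set.Icc u v) : (-1) ^ i * P.eval t ∈ Set.Icc α β := by
  have hu := h.lt_left hi hα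
  have hv := h.right_lt hi hβ
  constructor
  · by_contra! hlt
    rcases ht.1.eq_or_lt with rfl | hut
    · exact hlt.not_ge h.le_eval
    · exact h.alternates.not_le_eval_of_lt hi hu hut (ht.2.trans_lt hv) hα (by linarith)
        h.le_eval hlt.le
  · by_contra! hlt
    rcases ht.2.eq_or_lt with rfl | hut
    · exact hlt.not_ge h.eval_le
    · exact h.alternates.not_le_eval_of_lt hi (hu.trans_le ht.1) hut hv (by linarith) hβ hlt.le
        h.eval_le

theorem abs_eval_le_one (h : IsSegment n P y i α β u v) (hi : i < n) (hα : -1 < α) (hαβ : α ≤ β)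
    (hβ : β < 1) {t : ℝ} (ht : t ∈ Set.Icc u v) : |P.eval t| ≤ 1 := by
  have := h.eval_mem_Icc hi hα hαβ hβ ht
  have e : |P.eval t| = |(-1) ^ i * P.eval t| := by rw [abs_mul, abs_neg_one_pow, one_mul]
  rw [e, abs_le]
  exact ⟨by linarith [this.1], by linarith [this.2]⟩

end IsSegment

/-- If `2 ^ (n - 1) * ∏ (t - z i)` is at most `1` in modulus on an interval of length `ℓ`, then its
zeros are at a bounded distance from the interval: for every zero `z m` the interval has a point
at distance at least `ℓ / (2 * n)` from all the other zeros. -/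
theorem abs_sub_le_of_prod_le_one {n : ℕ} {z : ℕ → ℝ} {u ℓ : ℝ} (hℓ : 0 < ℓ)
    (h : ∀ t ∈ Set.Icc u (u + ℓ), |2 ^ (n - 1) * ∏ i ∈ Finset.range n, (t - z i)| ≤ 1)
    {m : ℕ} (hm : m < n) : |z m - u| ≤ ℓ + ((ℓ / (2 * n)) ^ (n - 1))⁻¹ := by
  have hn : (0 : ℝ) < n := by exact_mod_cast (by omega : 0 < n)
  set δ : ℝ := ℓ / (2 * n) with hδ
  have hδ0 : 0 < δ := by positivity
  have hδn : 2 * n * δ = ℓ := by rw [hδ]; field_simp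
  -- The `n` points `u + 2 * δ * q` are `2 * δ` apart, so that some of them is not close to any of
  -- the `n - 1` other zeros.
  obtain ⟨q, hq, hfar⟩ : ∃ q ∈ Finset.range n, ∀ l ∈ (Finset.range n).erase m,
      δ ≤ |u + 2 * δ * q - z l| := by
    by_contra! hcon
    have hcon' : ∀ q : ℕ, ∃ l, q ∈ Finset.range n →
        l ∈ (Finset.range n).erase m ∧ |u + 2 * δ * q - z l| < δ := by
      intro q
      by_cases hq : q ∈ Finset.range n
      · obtain ⟨l, hl⟩ := hcon q hq
        exact ⟨l, fun _ => hl⟩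
      · exact ⟨0, fun h => absurd h hq⟩
    choose f hf using hcon'
    have hcard : ((Finset.range n).erase m).card < (Finset.range n).card :=
      Finset.card_erase_lt_of_mem (Finset.mem_range.mpr hm)
    obtain ⟨a, ha, b, hb, hab, hfab⟩ :=
      Finset.exists_ne_map_eq_of_card_lt_of_maps_to hcard (fun q hq => (hf q hq).1)
    have h1 := (hf a ha).2
    have h2 := (hf b hb).2
    rw [← hfab] at h2
    rw [abs_lt] at h1 h2
    rcases Nat.lt_or_gt_of_ne hab with hlt | hlt
    · have : (a : ℝ) + 1 ≤ b := by exact_mod_cast hlt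
      nlinarith
    · have : (b : ℝ) + 1 ≤ a := by exact_mod_cast hlt
      nlinarith
  have hqn : (q : ℝ) ≤ n := by exact_mod_cast (Finset.mem_range.mp hq).le
  set t : ℝ := u + 2 * δ * q with ht
  have hq0 : (0 : ℝ) ≤ q := q.cast_nonneg
  have htu : 0 ≤ 2 * δ * q := by positivity
  have htl : 2 * δ * q ≤ ℓ := by nlinarith
  have h1 := h t ⟨by linarith, by linarith⟩
  rw [← Finset.mul_prod_erase _ _ (Finset.mem_range.mpr hm), abs_mul, abs_mul,
    abs_of_pos (by positivity), Finset.abs_prod] at h1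
  have h2 : δ ^ (n - 1) ≤ ∏ l ∈ (Finset.range n).erase m, |t - z l| := by
    have := Finset.prod_le_prod (s := (Finset.range n).erase m) (f := fun _ => δ)
      (fun _ _ => hδ0.le) hfar
    rwa [Finset.prod_const, Finset.card_erase_of_mem (Finset.mem_range.mpr hm),
      Finset.card_range] at this
  have h3 : |t - z m| * δ ^ (n - 1) ≤ 1 := by
    calc |t - z m| * δ ^ (n - 1) ≤ |t - z m| * ∏ l ∈ (Finset.range n).erase m, |t - z l| := by
          gcongr
      _ ≤ 2 ^ (n - 1) * (|t - z m| * ∏ l ∈ (Finset.range n).erase m, |t - z l|) :=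
          le_mul_of_one_le_left (by positivity) (one_le_pow₀ (by norm_num))
      _ ≤ 1 := h1
  have h4 : |t - z m| ≤ (δ ^ (n - 1))⁻¹ := by
    rw [← one_div, le_div_iff₀ (by positivity)]; exact h3
  calc |z m - u| = |(t - u) - (t - z m)| := by congr 1; ring
    _ ≤ |t - u| + |t - z m| := abs_sub _ _
    _ ≤ ℓ + (δ ^ (n - 1))⁻¹ := by
        gcongr
        rw [abs_le]; constructor <;> linarith

namespace IsSegment

variable {n i : ℕ} {P : ℝ[X]} {y : ℕ → ℝ} {α β u v : ℝ}

/-- The two outermost alternation points may be placed at distance `1` from the outermost zeros. -/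
theorem exists_ends (h : IsSegment n P y i α β u v) (hn : 2 ≤ n) (hi : i < n) (hα : -1 < α)
    (hβ : β < 1) {z : ℕ → ℝ} (hz : ∀ k < n, y (k + 1) < z k ∧ z k < y k)
    (hP : P = C (2 ^ (n - 1)) * ∏ k ∈ Finset.range n, (X - C (z k))) :
    ∃ y' : ℕ → ℝ, IsSegment n P y' i α β u v ∧ (∀ k, 0 < k → k < n → y' k = y k) ∧
      y' 0 = z 0 + 1 ∧ y' n = z (n - 1) - 1 ∧
      2 ≤ P.eval (y' 0) ∧ 2 ≤ (-1) ^ n * P.eval (y' n) := by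
  have hanti := h.alternates.strictAntiOn
  have hzanti : ∀ a b, a ≤ b → b < n → z b ≤ z a := by
    intro a b hab hb
    rcases hab.eq_or_lt with rfl | hab
    · exact le_rfl
    have h1 := (hz a (by omega)).1
    have h2 := (hz b hb).2
    have h3 := hanti.antitoneOn (a := a + 1) (b := b) (by simp; omega) (by simp; omega) hab
    linarith
  have h2n : (2 : ℝ) ≤ 2 ^ (n - 1) := by
    calc (2 : ℝ) = 2 ^ 1 := by norm_num
      _ ≤ 2 ^ (n - 1) := pow_le_pow_right₀ (by norm_num) (by omega)
  have heval : ∀ t, P.eval t = 2 ^ (n - 1) * ∏ k ∈ Finset.range n, (t - z k) := by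
    intro t; rw [hP]; simp [eval_prod]
  have hright : ∀ t, z 0 + 1 ≤ t → 2 ≤ P.eval t := by
    intro t ht
    have : (1 : ℝ) ≤ ∏ k ∈ Finset.range n, (t - z k) := by
      refine Finset.one_le_prod fun k hk => ?_
      have := hzanti 0 k (by omega) (Finset.mem_range.mp hk)
      linarith
    rw [heval]; nlinarith
  have hleft : ∀ t, t ≤ z (n - 1) - 1 → 2 ≤ (-1) ^ n * P.eval t := by
    intro t ht
    have : (1 : ℝ) ≤ ∏ k ∈ Finset.range n, ((-1) * (t - z k)) := by
      refine Finset.one_le_prod fun k hk => ?_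
      have hk := Finset.mem_range.mp hk
      have := hzanti k (n - 1) (by omega) (by omega)
      linarith
    rw [Finset.prod_mul_distrib, Finset.prod_const, Finset.card_range] at this
    rw [heval, mul_left_comm]; nlinarith
  have hz0 := hz 0 (by omega)
  have hzn := hz (n - 1) (by omega)
  rw [Nat.sub_add_cancel (by omega)] at hzn
  set y' : ℕ → ℝ := fun k => if k = 0 then z 0 + 1 else if k = n then z (n - 1) - 1 else y k
    with hy'
  have hy0 : y' 0 = z 0 + 1 := by simp [hy']
  have hyn : y' n = z (n - 1) - 1 := by simp [hy']; omega
  have hym : ∀ k, 0 < k → k < n → y' k = y k := by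
    intro k h0 hk
    simp only [hy']
    rw [if_neg (by omega), if_neg (by omega)]
  refine ⟨y', ⟨⟨h.alternates.natDegree_le, h.alternates.coeff_eq, ?_, ?_⟩, ?_, h.le, ?_, h.le_eval,
    h.eval_le⟩, hym, hy0, hyn, ?_, ?_⟩
  · intro k hk
    rcases Nat.eq_zero_or_pos k with rfl | hk0
    · rw [hy0, hym _ (by omega) (by omega)]; linarith
    · rw [hym k hk0 hk]
      rcases Nat.lt_or_ge (k + 1) n with hlt | hge
      · rw [hym _ (by omega) hlt]; exact h.alternates.succ_lt k hk
      · obtain rfl : n = k + 1 := by omega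
        rw [hyn]; simp only [Nat.add_sub_cancel] at hzn ⊢; linarith
  · intro k hk
    rcases Nat.eq_zero_or_pos k with rfl | hk0
    · rw [pow_zero, one_mul, hy0]; linarith [hright _ le_rfl]
    · rcases hk.eq_or_lt with rfl | hk
      · rw [hyn]; linarith [hleft _ le_rfl]
      · rw [hym k hk0 hk]; exact h.alternates.one_le k hk.le
  · rcases Nat.lt_or_ge (i + 1) n with hlt | hge
    · rw [hym _ (by omega) hlt]; exact h.le_left
    · obtain rfl : n = i + 1 := by omega
      rw [hyn]
      by_contra! hcon
      have h1 := hleft u hcon.le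
      have h2 := h.le_eval
      rw [pow_succ] at h1; linarith
  · rcases Nat.eq_zero_or_pos i with rfl | hi0
    · rw [hy0]
      by_contra! hcon
      have h1 := hright v hcon.le
      have h2 := h.eval_le
      rw [pow_zero] at h2; linarith
    · rw [hym _ hi0 hi]; exact h.right_le
  · rw [hy0]; exact hright _ le_rfl
  · rw [hyn]; exact hleft _ le_rfl

end IsSegment

/-! ### Existence of a longest segment -/

namespace IsSegment

variable {n i : ℕ} {P : ℝ[X]} {y : ℕ → ℝ} {α β u v : ℝ}

/-- The configurations of zeros `z`, alternation points `y` and right end `w` of a segment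
`[0, w]`, confined to a box of size `M`. -/
def configurations (n i : ℕ) (α β M : ℝ) : Set ((ℕ → ℝ) × (ℕ → ℝ) × ℝ) :=
  {c | ((∀ k, c.1 k ∈ Set.Icc (-M) M) ∧ (∀ k, c.2.1 k ∈ Set.Icc (-M) M) ∧ c.2.2 ∈ Set.Icc 0 M) ∧
    (∀ k < n, c.2.1 (k + 1) ≤ c.2.1 k) ∧
    (∀ k ≤ n, 1 ≤ (-1) ^ k * (2 ^ (n - 1) * ∏ l ∈ Finset.range n, (c.2.1 k - c.1 l))) ∧
    c.2.1 (i + 1) ≤ 0 ∧ c.2.2 ≤ c.2.1 i ∧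
    α ≤ (-1) ^ i * (2 ^ (n - 1) * ∏ l ∈ Finset.range n, (0 - c.1 l)) ∧
    (-1) ^ i * (2 ^ (n - 1) * ∏ l ∈ Finset.range n, (c.2.2 - c.1 l)) ≤ β}

theorem isCompact_configurations (n i : ℕ) (α β M : ℝ) :
    IsCompact (configurations n i α β M) := by
  have hbox : IsCompact ((Set.univ.pi fun _ : ℕ => Set.Icc (-M) M) ×ˢ
      ((Set.univ.pi fun _ : ℕ => Set.Icc (-M) M) ×ˢ Set.Icc (0 : ℝ) M)) :=
    (isCompact_univ_pi fun _ => isCompact_Icc).prod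
      ((isCompact_univ_pi fun _ => isCompact_Icc).prod isCompact_Icc)
  refine hbox.of_isClosed_subset ?_ fun c hc => ?_
  · unfold configurations
    simp only [Set.ofPred_and, Set.ofPred_forall, Set.mem_Icc]
    refine IsClosed.inter (.inter (isClosed_iInter fun k => .inter ?_ ?_)
      (.inter (isClosed_iInter fun k => .inter ?_ ?_) (.inter ?_ ?_)))
      (.inter (isClosed_iInter fun k => isClosed_iInter fun _ => ?_)
      (.inter (isClosed_iInter fun k => isClosed_iInter fun _ => ?_)
      (.inter ?_ (.inter ?_ (.inter ?_ ?_)))))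
    all_goals exact isClosed_le (by fun_prop) (by fun_prop)
  · exact ⟨fun k _ => hc.1.1 k, fun k _ => hc.1.2.1 k, hc.1.2.2⟩

theorem of_mem_configurations {M w : ℝ} {z : ℕ → ℝ}
    (h : (z, y, w) ∈ configurations n i α β M) :
    IsSegment n (C (2 ^ (n - 1)) * ∏ l ∈ Finset.range n, (X - C (z l))) y i α β 0 w := by
  obtain ⟨⟨-, -, hw⟩, hy, hone, hl, hr, hα, hβ⟩ := h
  have hM : (∏ l ∈ Finset.range n, (X - C (z l))).Monic :=
    monic_prod_of_monic _ _ fun i _ => monic_X_sub_C _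
  have hMd : (∏ l ∈ Finset.range n, (X - C (z l))).natDegree = n := by
    rw [natDegree_prod_of_monic _ _ fun i _ => monic_X_sub_C _]; simp
  have heval : ∀ t, (C (2 ^ (n - 1)) * ∏ l ∈ Finset.range n, (X - C (z l))).eval t =
      2 ^ (n - 1) * ∏ k ∈ Finset.range n, (t - z k) := by
    intro t; simp [eval_prod]
  refine ⟨⟨(natDegree_C_mul_le _ _).trans hMd.le, ?_, fun k hk => ?_, fun k hk => ?_⟩, hl, hw.1, hr,
    ?_, ?_⟩
  · have := hM.coeff_natDegree
    rw [hMd] at this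
    rw [coeff_C_mul, this, mul_one]
  · refine lt_of_le_of_ne (hy k hk) fun heq => ?_
    have h1 := hone k hk.le
    have h2 := hone (k + 1) hk
    simp only [heq, pow_succ] at h1 h2
    linarith
  · rw [heval]; exact hone k hk
  · rw [heval]; exact hα
  · rw [heval]; exact hβ

/-- After a translation, every segment of length at least `ℓ` is one of a bounded set of
configurations. -/
theorem exists_mem_configurations (h : IsSegment n P y i α β u v) (hn : 2 ≤ n) (hi : i < n)
    (hα : -1 < α) (hαβ : α ≤ β) (hβ : β < 1) {ℓ : ℝ} (hℓ : 0 < ℓ) (huv : ℓ ≤ v - u) :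
    ∃ z y, (z, y, v - u) ∈
      configurations n i α β (ℓ + ((ℓ / (2 * n)) ^ (n - 1))⁻¹ + 1) := by
  obtain ⟨z, hz, hP⟩ := h.alternates.exists_eq_prod
  set B : ℝ := ℓ + ((ℓ / (2 * n)) ^ (n - 1))⁻¹ with hB
  have heval : ∀ t, P.eval t = 2 ^ (n - 1) * ∏ k ∈ Finset.range n, (t - z k) := by
    intro t; rw [hP]; simp [eval_prod]
  have hzB : ∀ k < n, |z k - u| ≤ B := fun k hk => abs_sub_le_of_prod_le_one hℓ (fun t ht => by
    rw [← heval]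
    exact h.abs_eval_le_one hi hα hαβ hβ ⟨ht.1, by linarith [ht.2]⟩) hk
  have hB0 : 0 ≤ B := (abs_nonneg _).trans (hzB i hi)
  obtain ⟨y', hseg, hym, hy0, hyn, -, -⟩ := h.exists_ends hn hi hα hβ hz hP
  have hyB : ∀ k ≤ n, |y' k - u| ≤ B + 1 := by
    intro k hk
    rcases Nat.eq_zero_or_pos k with rfl | hk0
    · have := abs_le.mp (hzB 0 (by omega))
      rw [hy0, abs_le]; constructor <;> linarith
    · rcases hk.eq_or_lt with rfl | hk
      · have := abs_le.mp (hzB (k - 1) (by omega))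
        rw [hyn, abs_le]; constructor <;> linarith
      · have h1 := abs_le.mp (hzB k hk)
        have h2 := abs_le.mp (hzB (k - 1) (by omega))
        have h3 := (hz k hk).2
        have h4 := (hz (k - 1) (by omega)).1
        rw [Nat.sub_add_cancel hk0] at h4
        rw [hym k hk0 hk, abs_le]; constructor <;> linarith
  have hprod : ∀ t, 2 ^ (n - 1) * ∏ l ∈ Finset.range n, (t - if l < n then z l - u else 0) =
      P.eval (t + u) := by
    intro t
    rw [heval]
    congr 1
    refine Finset.prod_congr rfl fun l hl => ?_
    rw [if_pos (Finset.mem_range.mp hl)]; ring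
  refine ⟨fun k => if k < n then z k - u else 0, fun k => if k ≤ n then y' k - u else 0,
    ⟨fun k => ?_, fun k => ?_, ?_, ?_⟩, fun k hk => ?_, fun k hk => ?_, ?_, ?_, ?_, ?_⟩
  · by_cases hk : k < n
    · have := abs_le.mp (hzB k hk)
      simp only [if_pos hk, Set.mem_Icc]; constructor <;> linarith
    · simp only [if_neg hk, Set.mem_Icc]; constructor <;> linarith
  · by_cases hk : k ≤ n
    · have := abs_le.mp (hyB k hk)
      simp only [if_pos hk, Set.mem_Icc]; constructor <;> linarith
    · simp only [if_neg hk, Set.mem_Icc]; constructor <;> linarith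
  · simpa using h.le
  · have h1 := abs_le.mp (hyB i hi.le)
    have h2 := hseg.right_le
    show v - u ≤ B + 1
    linarith
  · have := hseg.alternates.succ_lt k hk
    simp only [if_pos hk.le, if_pos (Nat.succ_le_of_lt hk)]
    linarith
  · simp only [hprod, if_pos hk, sub_add_cancel]
    exact hseg.alternates.one_le k hk
  · have := hseg.le_left
    simp only [if_pos (Nat.succ_le_of_lt hi)]; linarith
  · have := hseg.right_le
    simp only [if_pos hi.le]; linarith
  · simp only [hprod, zero_add]; exact h.le_eval
  · simp only [hprod, sub_add_cancel]; exact h.eval_le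

/-- Among all segments with given levels there is a longest one. -/
theorem exists_longest (h : IsSegment n P y i α β u v) (hn : 2 ≤ n) (hi : i < n)
    (hα : -1 < α) (hαβ : α ≤ β) (hβ : β < 1) (huv : u < v) :
    ∃ P' y' u' v', IsSegment n P' y' i α β u' v' ∧ v - u ≤ v' - u' ∧
      ∀ P'' y'' u'' v'', IsSegment n P'' y'' i α β u'' v'' → v'' - u'' ≤ v' - u' := by
  have hℓ : 0 < v - u := sub_pos.mpr huv
  obtain ⟨z₀, y₀, h₀⟩ := h.exists_mem_configurations hn hi hα hαβ hβ hℓ le_rfl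
  obtain ⟨⟨z, y₁, w⟩, hmem, hmax⟩ := (isCompact_configurations n i α β _).exists_isMaxOn ⟨_, h₀⟩
    (f := fun c => c.2.2) (by fun_prop)
  refine ⟨_, y₁, 0, w, of_mem_configurations hmem, ?_, fun P'' y'' u'' v'' h'' => ?_⟩
  · simpa using hmax h₀
  · rcases le_total (v - u) (v'' - u'') with hle | hle
    · obtain ⟨z₂, y₂, h₂⟩ := h''.exists_mem_configurations hn hi hα hαβ hβ hℓ hle
      simpa using hmax h₂
    · refine hle.trans ?_
      simpa using hmax h₀

end IsSegment

/-! ### Longest segments have critical values of modulus one -/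

namespace IsSegment

variable {n i : ℕ} {P : ℝ[X]} {y : ℕ → ℝ} {α β u v : ℝ}

/-- On a longest segment the value at every inner alternation point is exactly `± 1`. If the value
at `y k` had larger modulus, one could add to `P` a small multiple of
`-(c - y k) * (X - c) * ∏ (X - y l)`, the product over the inner `l ≠ k` and with `c` between `u`
and `v`. The result still alternates, as it has changed only where there was room, and the values
at `u` and at `v` have moved strictly into the permitted range, so that a longer segment exists. -/
theorem eval_eq_one_of_longest (h : IsSegment n P y i α β u v) (hn : 2 ≤ n) (hi : i < n)
    (hα : -1 < α) (hβ : β < 1) (huv : u < v)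
    (hmax : ∀ P' y' u' v', IsSegment n P' y' i α β u' v' → v' - u' ≤ v - u)
    {k : ℕ} (hk0 : 0 < k) (hk : k < n) : (-1) ^ k * P.eval (y k) = 1 := by
  obtain ⟨z, hz, hP⟩ := h.alternates.exists_eq_prod
  obtain ⟨y', h', hym, -, -, hy0, hyn⟩ := h.exists_ends hn hi hα hβ hz hP
  rw [← hym k hk0 hk]
  clear hym hz hP z h
  refine le_antisymm ?_ (h'.alternates.one_le k hk.le)
  by_contra! hlt
  have hu := h'.lt_left hi hα
  have hv := h'.right_lt hi hβ
  obtain ⟨c, huc, hcv⟩ := exists_between huv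
  set s : ℝ := (-1) ^ i with hs
  set p : ℝ[X] := ∏ l ∈ (Finset.Ioo 0 n).erase k, (X - C (y' l)) with hp
  set g : ℝ[X] := C (-(c - y' k)) * ((X - C c) * p) with hg
  have hkmem : k ∈ Finset.Ioo 0 n := Finset.mem_Ioo.mpr ⟨hk0, hk⟩
  have hpe : ∀ x, p.eval x = ∏ l ∈ (Finset.Ioo 0 n).erase k, (x - y' l) := by
    intro x; simp [hp, eval_prod]
  have hge : ∀ x, g.eval x = -(c - y' k) * ((x - c) * p.eval x) := by
    intro x; simp [hg]
  have hgdeg : g.natDegree < n := by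
    have h1 : p.natDegree = n - 2 := by
      rw [hp, natDegree_prod_of_monic _ _ fun i _ => monic_X_sub_C _]
      simp only [natDegree_X_sub_C, Finset.sum_const, Finset.card_erase_of_mem hkmem, Nat.card_Ioo]
      simp; omega
    have h2 : g.natDegree ≤ 1 + (n - 2) := by
      refine (natDegree_C_mul_le _ _).trans (natDegree_mul_le.trans ?_)
      rw [h1, natDegree_X_sub_C]
    omega
  -- On the whole lap `c - y k` has the sign of `(-1) ^ i * p`.
  have hsign : ∀ x ∈ Set.Ioo (y' (i + 1)) (y' i), 0 < (c - y' k) * (s * p.eval x) := by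
    intro x hx
    have h1 := h'.alternates.neg_one_pow_mul_prod_interior_pos hi hx
    rw [← Finset.mul_prod_erase _ _ hkmem, ← hpe] at h1
    have h2 : 0 < (c - y' k) * (x - y' k) := by
      rcases Nat.lt_or_ge i k with hik | hik
      · have := h'.alternates.le_of_index_le (Nat.succ_le_of_lt hik) hk.le
        exact mul_pos (by linarith) (by linarith [hx.1])
      · have := h'.alternates.le_of_index_le hik hi.le
        exact mul_pos_of_neg_of_neg (by linarith) (by linarith [hx.2])
    have h3 : x - y' k ≠ 0 := by rintro h0; simp [h0] at h2
    have h4 : 0 < (x - y' k) ^ 2 := by positivity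
    have h5 := mul_pos h1 h2
    refine pos_of_mul_pos_left (b := (x - y' k) ^ 2) ?_ h4.le
    calc 0 < _ := h5
      _ = _ := by ring
  have hgu : 0 < s * g.eval u := by
    have := mul_pos (hsign u ⟨hu, by linarith⟩) (sub_pos.mpr huc)
    rw [hge]; linarith
  have hgv : s * g.eval v < 0 := by
    have := mul_pos (hsign v ⟨by linarith, hv⟩) (sub_pos.mpr hcv)
    rw [hge]; linarith
  have hcont : ∀ l, 1 < (-1) ^ l * P.eval (y' l) →
      ∀ᶠ ε in 𝓝[>] (0 : ℝ), 1 ≤ (-1) ^ l * (P.eval (y' l) + ε * g.eval (y' l)) := by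
    intro l hl
    have hc : Continuous fun ε : ℝ => (-1) ^ l * (P.eval (y' l) + ε * g.eval (y' l)) := by fun_prop
    have : ∀ᶠ ε in 𝓝 (0 : ℝ), 1 < (-1) ^ l * (P.eval (y' l) + ε * g.eval (y' l)) :=
      hc.continuousAt.eventually (lt_mem_nhds (by simpa using hl))
    exact (this.filter_mono nhdsWithin_le_nhds).mono fun ε hε => hε.le
  obtain ⟨ε, ⟨⟨hε0, hεn⟩, hεk⟩, hε⟩ := (((hcont 0 (by simp; linarith)).and
    (hcont n (by linarith))).and ((hcont k hlt).and self_mem_nhdsWithin)).exists.imp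
      fun ε h => (⟨⟨h.1, h.2.1⟩, h.2.2⟩ : (_ ∧ _) ∧ _)
  have hε : 0 < ε := hε
  have heval : ∀ x, (P + C ε * g).eval x = P.eval x + ε * g.eval x := by intro x; simp
  have halt : Alternates n (P + C ε * g) y' := by
    refine ⟨?_, ?_, h'.alternates.succ_lt, fun l hl => ?_⟩
    · exact (natDegree_add_le _ _).trans
        (max_le h'.alternates.natDegree_le ((natDegree_C_mul_le _ _).trans hgdeg.le))
    · rw [coeff_add, coeff_C_mul, coeff_eq_zero_of_natDegree_lt hgdeg, mul_zero, add_zero,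
        h'.alternates.coeff_eq]
    · rw [heval]
      rcases Nat.eq_zero_or_pos l with rfl | hl0
      · exact hε0
      rcases hl.eq_or_lt with rfl | hln
      · exact hεn
      by_cases hlk : l = k
      · rw [hlk]; exact hεk
      · have : p.eval (y' l) = 0 := by
          rw [hpe]
          exact Finset.prod_eq_zero (i := l) (by simp [hlk, hl0, hln]) (sub_self _)
        rw [hge, this, mul_zero, mul_zero, mul_zero, add_zero]
        exact h'.alternates.one_le l hl
  have hlt' : s * (P + C ε * g).eval v < β := by
    have := h'.eval_le
    rw [heval]; nlinarith
  have hc : Continuous fun t => s * (P + C ε * g).eval t := by fun_prop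
  have hev : ∀ᶠ t in 𝓝[>] v, s * (P + C ε * g).eval t < β ∧ t < y' i :=
    ((hc.continuousAt.eventually (gt_mem_nhds hlt')).and (gt_mem_nhds hv)).filter_mono
      nhdsWithin_le_nhds
  obtain ⟨t, ⟨ht1, ht2⟩, ht⟩ := (hev.and self_mem_nhdsWithin).exists
  have ht : v < t := ht
  have := hmax _ y' u t ⟨halt, hu.le, (huv.trans ht).le, ht2.le, by
    have := h'.le_eval
    rw [heval]; nlinarith, ht1.le⟩
  linarith

/-- For a longest segment the inner alternation points are critical points: otherwise one of them
could be moved to a point where the modulus is larger than `1`. -/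
theorem derivative_eval_eq_zero_of_longest (h : IsSegment n P y i α β u v) (hn : 2 ≤ n)
    (hi : i < n) (hα : -1 < α) (hβ : β < 1) (huv : u < v)
    (hmax : ∀ P' y' u' v', IsSegment n P' y' i α β u' v' → v' - u' ≤ v - u)
    {k : ℕ} (hk0 : 0 < k) (hk : k < n) : P.derivative.eval (y k) = 0 := by
  have h1 := h.eval_eq_one_of_longest hn hi hα hβ huv hmax hk0 hk
  have hu := h.lt_left hi hα
  have hv := h.right_lt hi hβ
  have hloc : IsLocalMax (fun t => (-1) ^ k * P.eval t) (y k) := by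
    by_contra hcon
    have hfreq : ∃ᶠ t in 𝓝 (y k), 1 < (-1) ^ k * P.eval t := by
      intro hev
      refine hcon (hev.mono fun t ht => ?_)
      show (-1) ^ k * P.eval t ≤ (-1) ^ k * P.eval (y k)
      rw [h1]; exact not_lt.mp ht
    have hk1 : y (k + 1) < y k := h.alternates.lt_of_index_lt (by omega) (by omega)
    have hk2 : y k < y (k - 1) := h.alternates.lt_of_index_lt (by omega) (by omega)
    have hlap : ∀ᶠ t in 𝓝 (y k), (k = i → v < t) ∧ (k = i + 1 → t < u) := by
      refine Filter.Eventually.and ?_ ?_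
      · by_cases hki : k = i
        · subst hki; exact (lt_mem_nhds hv).mono fun t ht _ => ht
        · exact Filter.Eventually.of_forall fun t ht => absurd ht hki
      · by_cases hki : k = i + 1
        · subst hki; exact (gt_mem_nhds hu).mono fun t ht _ => ht
        · exact Filter.Eventually.of_forall fun t ht => absurd ht hki
    obtain ⟨t, ht, ⟨ht1, ht2⟩, ht3, ht4⟩ :=
      (hfreq.and_eventually (((lt_mem_nhds hk1).and (gt_mem_nhds hk2)).and hlap)).exists
    have hyk : Function.update y k t k = t := Function.update_self ..
    have hyl : ∀ l, l ≠ k → Function.update y k t l = y l :=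
      fun l hl => Function.update_of_ne hl ..
    have hseg : IsSegment n P (Function.update y k t) i α β u v := by
      refine ⟨⟨h.alternates.natDegree_le, h.alternates.coeff_eq, fun l hl => ?_, fun l hl => ?_⟩,
        ?_, h.le, ?_, h.le_eval, h.eval_le⟩
      · by_cases hlk : l = k
        · subst hlk
          rw [hyk, hyl _ (by omega)]; exact ht1
        · by_cases hlk' : l + 1 = k
          · subst hlk'
            rw [hyk, hyl _ hlk]; simpa using ht2
          · rw [hyl _ hlk, hyl _ hlk']; exact h.alternates.succ_lt l hl
      · by_cases hlk : l = k
        · subst hlk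
          rw [hyk]; exact ht.le
        · rw [hyl _ hlk]; exact h.alternates.one_le l hl
      · by_cases hki : k = i + 1
        · rw [← hki, hyk]; exact (ht4 hki).le
        · rw [hyl _ (Ne.symm hki)]; exact h.le_left
      · by_cases hki : k = i
        · rw [← hki, hyk]; exact (ht3 hki).le
        · rw [hyl _ (Ne.symm hki)]; exact h.right_le
    have := hseg.eval_eq_one_of_longest hn hi hα hβ huv hmax hk0 hk
    rw [hyk] at this
    linarith
  have hd : HasDerivAt (fun t => (-1) ^ k * P.eval t) ((-1) ^ k * P.derivative.eval (y k)) (y k) :=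
    (P.hasDerivAt (y k)).const_mul _
  have := hloc.hasDerivAt_eq_zero hd
  simpa using this

end IsSegment

/-! ### Characterisation of the Chebyshev polynomial -/

open Polynomial.Chebyshev (T node)

namespace Alternates

variable {n : ℕ} {P : ℝ[X]} {y : ℕ → ℝ}

/-- The outermost alternation points may be chosen with values exactly `± 1`. -/
theorem exists_eval_eq_one (h : Alternates n P y) (hn : 2 ≤ n)
    (hone : ∀ k, 0 < k → k < n → (-1) ^ k * P.eval (y k) = 1) :
    ∃ y' : ℕ → ℝ, Alternates n P y' ∧ (∀ k, 0 < k → k < n → y' k = y k) ∧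
      ∀ k ≤ n, (-1) ^ k * P.eval (y' k) = 1 := by
  have hc : ∀ (k : ℕ) (s : Set ℝ), ContinuousOn (fun t => (-1) ^ k * P.eval t) s :=
    fun k s => (continuous_const.mul P.continuous).continuousOn
  obtain ⟨e₀, ⟨he₀, -⟩, he₀1⟩ := intermediate_value_Icc (h.succ_lt 0 (by omega)).le (hc 0 _)
    (show (1 : ℝ) ∈ Set.Icc _ _ from
      ⟨by linarith [h.eval_succ_le (i := 0) (by omega)], h.one_le 0 (by omega)⟩)
  have hn' : n - 1 + 1 = n := by omega
  have hlast := h.eval_succ_le (i := n - 1) (by omega)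
  have hpow : (-1 : ℝ) ^ n = -(-1) ^ (n - 1) := by
    conv_lhs => rw [← hn', pow_succ]
    ring
  have hlast1 := h.one_le (n - 1) (by omega)
  have hlast2 := h.succ_lt (n - 1) (by omega)
  rw [hn'] at hlast hlast2
  obtain ⟨eₙ, ⟨-, heₙ⟩, heₙ1⟩ := intermediate_value_Icc' hlast2.le (hc n _)
    (show (1 : ℝ) ∈ Set.Icc _ _ from ⟨by rw [hpow]; linarith, h.one_le n le_rfl⟩)
  simp only [pow_zero, one_mul, zero_add] at he₀1 heₙ1 he₀
  set y' : ℕ → ℝ := fun k => if k = 0 then e₀ else if k = n then eₙ else y k with hy'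
  have hy0 : y' 0 = e₀ := by simp [hy']
  have hyn : y' n = eₙ := by simp [hy']; omega
  have hym : ∀ k, 0 < k → k < n → y' k = y k := by
    intro k h0 hk
    simp only [hy']
    rw [if_neg (by omega), if_neg (by omega)]
  have hval : ∀ k ≤ n, (-1) ^ k * P.eval (y' k) = 1 := by
    intro k hk
    rcases Nat.eq_zero_or_pos k with rfl | hk0
    · rw [hy0, pow_zero, one_mul, he₀1]
    · rcases hk.eq_or_lt with rfl | hk
      · rw [hyn, heₙ1]
      · rw [hym k hk0 hk]; exact hone k hk0 hk
  refine ⟨y', ⟨h.natDegree_le, h.coeff_eq, fun k hk => ?_, fun k hk => (hval k hk).ge⟩, hym, hval⟩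
  have hle : y' (k + 1) ≤ y' k := by
    rcases Nat.eq_zero_or_pos k with rfl | hk0
    · rw [hy0, hym _ (by omega) (by omega)]; exact he₀
    · rw [hym k hk0 hk]
      rcases Nat.lt_or_ge (k + 1) n with hlt | hge
      · rw [hym _ (by omega) hlt]; exact h.succ_lt k hk |>.le
      · obtain rfl : n = k + 1 := by omega
        rw [hyn]; exact heₙ
  refine lt_of_le_of_ne hle fun heq => ?_
  have h1 := hval k hk.le
  have h2 := hval (k + 1) hk
  rw [heq, pow_succ] at h2
  linarith

/-- If the critical values are `± 1`, then `P` is bounded by `1` between the outermost points with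
this value. -/
theorem abs_eval_le_one (h : Alternates n P y) (hn : 2 ≤ n)
    (hone : ∀ k ≤ n, (-1) ^ k * P.eval (y k) = 1)
    (hcrit : ∀ k, 0 < k → k < n → P.derivative.eval (y k) = 0) {t : ℝ}
    (ht : t ∈ Set.Icc (y n) (y 0)) : |P.eval t| ≤ 1 := by
  have hsq : ∀ k ≤ n, P.eval (y k) ^ 2 = 1 := by
    intro k hk
    have := hone k hk
    have h1 : ((-1 : ℝ) ^ k) ^ 2 = 1 := by rw [← pow_mul, mul_comm, pow_mul]; norm_num
    calc P.eval (y k) ^ 2 = ((-1) ^ k) ^ 2 * P.eval (y k) ^ 2 := by rw [h1, one_mul]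
      _ = ((-1) ^ k * P.eval (y k)) ^ 2 := by ring
      _ = 1 := by rw [this, one_pow]
  have hcont : Continuous fun t => P.eval t ^ 2 := by fun_prop
  obtain ⟨x, hx, hmax⟩ := isCompact_Icc.exists_isMaxOn ⟨t, ht⟩ hcont.continuousOn
  have hx1 : P.eval x ^ 2 ≤ 1 := by
    by_cases hx0 : x = y 0
    · rw [hx0, hsq 0 (by omega)]
    by_cases hxn : x = y n
    · rw [hxn, hsq n le_rfl]
    have hloc : IsLocalMax (fun t => P.eval t ^ 2) x :=
      hmax.isLocalMax (Icc_mem_nhds (lt_of_le_of_ne hx.1 (Ne.symm hxn)) (lt_of_le_of_ne hx.2 hx0))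
    have hd : HasDerivAt (fun t => P.eval t ^ 2) (2 * P.eval x * P.derivative.eval x) x := by
      have := (P.hasDerivAt x).fun_pow 2
      simpa using this
    have hzero := hloc.hasDerivAt_eq_zero hd
    rcases mul_eq_zero.mp hzero with h0 | h0
    · have : P.eval x = 0 := by linarith
      rw [this]; norm_num
    have hinj : Set.InjOn y (Set.Ioo 0 n) :=
      h.strictAntiOn.injOn.mono fun k hk => hk.2.le
    obtain ⟨k, -, hk, rfl⟩ := exists_eq_of_derivative_eval_eq_zero (by omega) h.natDegree_le
      (by rw [h.coeff_eq]; positivity) hinj hcrit h0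
    rw [hsq k hk.le]
  have := (hmax ht).trans hx1
  exact (sq_le_one_iff_abs_le_one _).mp this

end Alternates

theorem coeff_comp_linear {n : ℕ} {P : ℝ[X]} (hP : P.natDegree ≤ n) (m c : ℝ) :
    (P.comp (C m + C c * X)).coeff n = P.coeff n * c ^ n := by
  rcases hP.eq_or_lt with rfl | hlt
  · by_cases hc : c = 0
    · subst hc
      simp only [map_zero, zero_mul, add_zero, comp_C, coeff_C]
      by_cases h0 : P.natDegree = 0
      · rw [if_pos h0, h0, pow_zero, mul_one]
        rw [eq_C_of_natDegree_eq_zero h0]; simp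
      · rw [if_neg h0, zero_pow h0, mul_zero]
    · have hd : (C m + C c * X).natDegree = 1 := by
        rw [add_comm]; exact natDegree_linear hc
      have := coeff_comp_degree_mul_degree (p := P) (q := C m + C c * X) (by omega)
      rw [hd, mul_one] at this
      rw [this, leadingCoeff, leadingCoeff, hd]
      simp [coeff_C]
  · rw [coeff_eq_zero_of_natDegree_lt hlt, zero_mul]
    refine coeff_eq_zero_of_natDegree_lt (natDegree_comp_le.trans_lt ?_)
    have : (C m + C c * X).natDegree ≤ 1 := by compute_degree
    nlinarith

theorem eq_self_of_strictMonoOn_Iic {n : ℕ} {f : ℕ → ℕ} (hf : ∀ k < n, f k < f (k + 1))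
    (hn : f n ≤ n) {k : ℕ} (hk : k ≤ n) : f k = k := by
  have h1 : ∀ k ≤ n, k ≤ f k := by
    intro k hk
    induction k with
    | zero => omega
    | succ k ih => have := ih (by omega); have := hf k (by omega); omega
  have h2 : ∀ m ≤ n, f (n - m) ≤ n - m := by
    intro m hm
    induction m with
    | zero => simpa using hn
    | succ m ih =>
      have h3 := ih (by omega)
      have h4 := hf (n - (m + 1)) (by omega)
      rw [show n - (m + 1) + 1 = n - m by omega] at h4
      omega
  have := h2 (n - k) (by omega)
  rw [Nat.sub_sub_self hk] at this
  exact le_antisymm this (h1 k hk)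

/-- Up to a translation, the Chebyshev polynomial is the only alternating polynomial all of whose
critical values are `± 1`, and its alternation points are the Chebyshev nodes. -/
theorem Alternates.exists_eq_chebyshev {n : ℕ} {P : ℝ[X]} {y : ℕ → ℝ} (h : Alternates n P y)
    (hn : 2 ≤ n) (hone : ∀ k, 0 < k → k < n → (-1) ^ k * P.eval (y k) = 1)
    (hcrit : ∀ k, 0 < k → k < n → P.derivative.eval (y k) = 0) :
    ∃ m, (∀ t, P.eval (m + t) = (T ℝ n).eval t) ∧ ∀ k, 0 < k → k < n → y k = m + node n k := by
  obtain ⟨y', h', hym, hone'⟩ := h.exists_eval_eq_one hn hone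
  have hcrit' : ∀ k, 0 < k → k < n → P.derivative.eval (y' k) = 0 := by
    intro k h0 hk; rw [hym k h0 hk]; exact hcrit k h0 hk
  have hlt : y' n < y' 0 := h'.lt_of_index_lt (by omega) le_rfl
  set m : ℝ := (y' 0 + y' n) / 2 with hm
  set c : ℝ := (y' 0 - y' n) / 2 with hc
  have hc0 : 0 < c := by rw [hc]; linarith
  set Q : ℝ[X] := P.comp (C m + C c * X) with hQ
  have hQe : ∀ t, Q.eval t = P.eval (m + c * t) := by intro t; simp [hQ]
  have hQc : Q.coeff n = 2 ^ (n - 1) * c ^ n := by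
    rw [hQ, coeff_comp_linear h'.natDegree_le, h'.coeff_eq]
  have hQd : Q.natDegree ≤ n := by
    refine natDegree_comp_le.trans ?_
    have h1 : (C m + C c * X).natDegree ≤ 1 := by compute_degree
    have h2 := h'.natDegree_le
    nlinarith
  have hQdeg : Q.degree ≤ n := degree_le_of_natDegree_le hQd
  have hQb : ∀ x ∈ Set.Icc (-1) 1, |Q.eval x| ≤ 1 := by
    intro x hx
    rw [hQe]
    refine h'.abs_eval_le_one hn hone' hcrit' ⟨?_, ?_⟩
    · have : y' n = m - c := by rw [hm, hc]; ring
      nlinarith [hx.1]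
    · have : y' 0 = m + c := by rw [hm, hc]; ring
      nlinarith [hx.2]
  have hTc : (T ℝ n).coeff n = 2 ^ (n - 1) := by
    have h1 : (T ℝ n).natDegree = n := by simp [Chebyshev.natDegree_T]
    have h2 := Chebyshev.leadingCoeff_T ℝ (n : ℤ)
    rw [leadingCoeff, h1] at h2
    simpa using h2
  have hyt : ∀ k, m + c * ((y' k - m) / c) = y' k := by
    intro k; field_simp; ring
  have hyle : ∀ k ≤ n, |(y' k - m) / c| ≤ 1 := by
    intro k hk
    have h1 := h'.le_of_index_le hk le_rfl
    have h2 := h'.le_of_index_le (Nat.zero_le k) hk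
    rw [abs_div, abs_of_pos hc0, div_le_one hc0, abs_le]
    constructor <;> rw [hm, hc] <;> linarith
  have hc1 : c = 1 := by
    have h2 : (0 : ℝ) < 2 ^ (n - 1) := by positivity
    apply le_antisymm
    · have h1 := Chebyshev.coeff_le_of_forall_abs_le_one hQdeg hQb
      rw [hQc] at h1
      have h3 : c ^ n ≤ 1 := by
        by_contra! hcon
        nlinarith
      exact (pow_le_one_iff_of_nonneg hc0.le (by omega)).mp h3
    · -- If `c < 1`, then `Q - c ^ n * T` has degree less than `n` and alternates in sign.
      by_contra! hcon
      have hcn : c ^ n < 1 := pow_lt_one₀ hc0.le hcon (by omega)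
      have hpos : ∀ k ≤ n,
          0 < (-1) ^ k * (Q - C (c ^ n) * T ℝ n).eval ((y' k - m) / c) := by
        intro k hk
        have h1 := Chebyshev.abs_eval_T_real_le_one n (hyle k hk)
        have h3 : (-1) ^ k * (T ℝ n).eval ((y' k - m) / c) ≤ 1 := by
          refine (le_abs_self _).trans ?_
          rwa [abs_mul, abs_neg_one_pow, one_mul]
        have h4 : (0 : ℝ) < c ^ n := by positivity
        rw [eval_sub, eval_mul, eval_C, hQe, hyt, mul_sub, hone' k hk]
        nlinarith
      refine not_alternating_of_degree_lt (m := n) (q := Q - C (c ^ n) * T ℝ n)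
        (v := fun k => (y' k - m) / c) ?_ (fun k hk => ?_) (fun k hk => (hpos k hk).le) ?_
      · rw [degree_lt_iff_coeff_zero]
        intro k hk
        rcases hk.eq_or_lt with rfl | hk
        · rw [coeff_sub, coeff_C_mul, hQc, hTc]; ring
        · rw [coeff_sub, coeff_C_mul, coeff_eq_zero_of_natDegree_lt (hQd.trans_lt hk),
            coeff_eq_zero_of_natDegree_lt (by simpa [Chebyshev.natDegree_T] using hk), mul_zero,
            sub_self]
      · have := h'.succ_lt k hk
        gcongr
      · simpa using hpos 0 (by omega)
  have hQT : Q = T ℝ n := by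
    refine (Chebyshev.coeff_eq_iff_of_forall_abs_le_one hQdeg hQb).mp ?_
    rw [hQc, hc1, one_pow, mul_one]
  simp only [hc1, one_mul, div_one] at hQe hyle
  refine ⟨m, fun t => by rw [← hQe, hQT], ?_⟩
  have hnode : ∀ k, ∃ l, k ≤ n → l ≤ n ∧ y' k - m = node n l := by
    intro k
    by_cases hk : k ≤ n
    · have h1 : |(T ℝ n).eval (y' k - m)| = 1 := by
        rw [← hQT, hQe, add_sub_cancel]
        have := hone' k hk
        rw [← abs_neg_one_pow (α := ℝ) k, ← one_mul |P.eval _|, ← abs_neg_one_pow (α := ℝ) k,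
          ← abs_mul, this]
        simp
      obtain ⟨l, hl, hle⟩ := (Chebyshev.abs_eval_T_real_eq_one_iff (by omega) _).mp h1
      exact ⟨l, fun _ => ⟨hl, hle⟩⟩
    · exact ⟨0, fun h => absurd h hk⟩
  choose f hf using hnode
  intro k hk0 hk
  have hfk : f k = k := by
    refine eq_self_of_strictMonoOn_Iic (n := n) (fun l hl => ?_) (hf n le_rfl).1 hk.le
    have h1 := h'.succ_lt l hl
    have h2 := (hf l hl.le).2
    have h3 := (hf (l + 1) hl).2
    by_contra! hcon
    have h4 : node n (f l) ≤ node n (f (l + 1)) := (Chebyshev.strictAntiOn_node n).antitoneOn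
      (a := f (l + 1)) (b := f l)
      (by simpa using Nat.lt_succ_of_le (hf (l + 1) hl).1)
      (by simpa using Nat.lt_succ_of_le (hf l hl.le).1) hcon
    linarith
  have := (hf k hk.le).2
  rw [hfk, hym k hk0 hk] at this
  linarith

/-- No segment of an alternating polynomial is longer than the corresponding band of the Chebyshev
polynomial. -/
theorem IsSegment.exists_chebyshev_segment {n i : ℕ} {P : ℝ[X]} {y : ℕ → ℝ} {α β u v : ℝ}
    (h : IsSegment n P y i α β u v) (hn : 2 ≤ n) (hi : i < n) (hα : -1 < α) (hαβ : α ≤ β)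
    (hβ : β < 1) (huv : u < v) :
    ∃ u' v', v - u ≤ v' - u' ∧ ∀ t ∈ Set.Icc u' v', (i + 1 < n → node n (i + 1) ≤ t) ∧
      (0 < i → t ≤ node n i) ∧ (-1) ^ i * (T ℝ n).eval t ∈ Set.Icc α β := by
  obtain ⟨P', y', u', v', h', hle, hmax⟩ := h.exists_longest hn hi hα hαβ hβ huv
  have huv' : u' < v' := by linarith
  obtain ⟨m, hm, hnode⟩ := h'.alternates.exists_eq_chebyshev hn
    (fun k => h'.eval_eq_one_of_longest hn hi hα hβ huv' hmax)
    (fun k => h'.derivative_eval_eq_zero_of_longest hn hi hα hβ huv' hmax)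
  refine ⟨u' - m, v' - m, by linarith, fun t ht => ⟨fun hin => ?_, fun hi0 => ?_, ?_⟩⟩
  · have := h'.le_left
    rw [hnode _ (by omega) hin] at this
    linarith [ht.1]
  · have := h'.right_le
    rw [hnode _ hi0 hi] at this
    linarith [ht.2]
  · rw [← hm]
    exact h'.eval_mem_Icc hi hα hαβ hβ ⟨by linarith [ht.1], by linarith [ht.2]⟩

/-! ### Laps and extrema -/

/-- The lap with number `i + 1` is the interval between the extrema with numbers `i + 1` and `i`,
where the first and the last lap are unbounded. -/
theorem mem_lap_succ_iff {n i : ℕ} (hi : i < n) {p : ℝ[X]} {y : ℕ → ℝ}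
    (hp : extremaSet p = y '' Set.Ioo 0 n) (hy : StrictAntiOn y (Set.Ioo 0 n)) (x : ℝ) :
    x ∈ lap p (i + 1) ↔ (i + 1 < n → y (i + 1) ≤ x) ∧ (0 < i → x ≤ y i) := by
  classical
  let F : Set ℝ → Finset ℕ := fun S => (Finset.Ioo 0 n).filter fun k => y k ∈ S
  have hF : ∀ S k, k ∈ F S ↔ (0 < k ∧ k < n) ∧ y k ∈ S := by
    intro S k; simp [F]
  have hcard : ∀ S : Set ℝ, (extremaSet p ∩ S).ncard = (F S).card := by
    intro S
    have e : extremaSet p ∩ S = y '' (F S : Set ℕ) := by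
      rw [hp]; ext r
      constructor
      · rintro ⟨⟨k, hk, rfl⟩, hS⟩; exact ⟨k, (hF S k).mpr ⟨hk, hS⟩, rfl⟩
      · rintro ⟨k, hk, rfl⟩
        obtain ⟨hk, hS⟩ := (hF S k).mp hk
        exact ⟨⟨k, hk, rfl⟩, hS⟩
    rw [e, Set.InjOn.ncard_image, Set.ncard_coe_finset]
    exact hy.injOn.mono fun k hk => ((hF S k).mp hk).1
  have hanti := hy.antitoneOn
  show _ ∧ _ ↔ _
  rw [hcard, hcard]
  refine and_congr ⟨fun h hin => ?_, fun h => ?_⟩ ⟨fun h hi0 => ?_, fun h => ?_⟩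
  · by_contra! hlt
    have hsub : Finset.Ioc 0 (i + 1) ⊆ F (Set.Ioi x) := by
      intro k hk
      have hk := Finset.mem_Ioc.mp hk
      refine (hF _ _).mpr ⟨⟨hk.1, by omega⟩, hlt.trans_le ?_⟩
      exact hanti ⟨hk.1, by omega⟩ ⟨by omega, hin⟩ hk.2
    have := Finset.card_le_card hsub
    rw [Nat.card_Ioc] at this
    omega
  · have hsub : F (Set.Ioi x) ⊆ Finset.Ioc 0 i := by
      intro k hk
      obtain ⟨hk, hxk⟩ := (hF _ _).mp hk
      have hxk : x < y k := hxk
      refine Finset.mem_Ioc.mpr ⟨hk.1, ?_⟩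
      by_contra! hik
      have h1 := hanti (a := i + 1) (b := k) ⟨by omega, by omega⟩ hk hik
      have h2 := h (by omega)
      linarith
    have := Finset.card_le_card hsub
    rw [Nat.card_Ioc] at this
    omega
  · by_contra! hlt
    have hsub : F (Set.Ici x) ⊆ Finset.Ioo 0 i := by
      intro k hk
      obtain ⟨hk, hxk⟩ := (hF _ _).mp hk
      have hxk : x ≤ y k := hxk
      refine Finset.mem_Ioo.mpr ⟨hk.1, ?_⟩
      by_contra! hik
      have h1 := hanti (a := i) (b := k) ⟨hi0, hi⟩ hk hik
      linarith
    have := Finset.card_le_card hsub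
    rw [Nat.card_Ioo] at this
    omega
  · rcases Nat.eq_zero_or_pos i with rfl | hi0
    · omega
    have hsub : Finset.Ioc 0 i ⊆ F (Set.Ici x) := by
      intro k hk
      have hk := Finset.mem_Ioc.mp hk
      refine (hF _ _).mpr ⟨⟨hk.1, by omega⟩, (h hi0).trans ?_⟩
      exact hanti ⟨hk.1, by omega⟩ ⟨hi0, hi⟩ hk.2
    have := Finset.card_le_card hsub
    rw [Nat.card_Ioc] at this
    omega

theorem IsRealRooted.natDegree_eq {n : ℕ} {p : ℝ[X]} (hp : IsRealRooted n p) : p.natDegree = n :=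
  natDegree_eq_of_degree_eq_some hp.1

theorem IsRealRooted.leadingCoeff_ne_zero {n : ℕ} {p : ℝ[X]} (hp : IsRealRooted n p) :
    p.leadingCoeff ≠ 0 := by
  rw [Ne, leadingCoeff_eq_zero]
  rintro rfl
  simpa using hp.1

theorem IsRealRooted.exists_eq_prod {n : ℕ} {p : ℝ[X]} (hp : IsRealRooted n p) :
    ∃ z : ℕ → ℝ, StrictAntiOn z (Set.Iio n) ∧
      p = C p.leadingCoeff * ∏ i ∈ Finset.range n, (X - C (z i)) := by
  set e := p.roots.toFinset.orderEmbOfFin hp.2 with he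
  set z : ℕ → ℝ := fun i => if hi : n - 1 - i < n then e ⟨n - 1 - i, hi⟩ else 0 with hz
  have hzi : ∀ i (hi : i < n), z i = e ⟨n - 1 - i, by omega⟩ := by
    intro i hi; simp only [hz]; rw [dif_pos]
  have hanti : StrictAntiOn z (Set.Iio n) := by
    intro a ha b hb hab
    simp only [Set.mem_Iio] at ha hb
    rw [hzi a ha, hzi b hb]
    exact e.strictMono (by rw [Fin.lt_def]; simp only; omega)
  refine ⟨z, hanti, eq_C_mul_prod_of_eval_eq_zero hp.natDegree_eq.le ?_ ?_ fun i hi => ?_⟩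
  · rw [leadingCoeff, hp.natDegree_eq]
  · simpa using hanti.injOn
  · rw [hzi i hi]
    have := p.roots.toFinset.orderEmbOfFin_mem hp.2 ⟨n - 1 - i, by omega⟩
    exact isRoot_of_mem_roots (Multiset.mem_toFinset.mp this)

/-- The local extrema of a real-rooted polynomial are one point between any two neighbouring zeros,
and the values there alternate in sign. -/
theorem IsRealRooted.exists_extrema {n : ℕ} (hn : 2 ≤ n) {p : ℝ[X]} (hp : IsRealRooted n p) :
    ∃ y : ℕ → ℝ, extremaSet p = y '' Set.Ioo 0 n ∧ StrictAntiOn y (Set.Ioo 0 n) ∧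
      ∀ k ∈ Set.Ioo 0 n, 0 < (-1) ^ k * (p.leadingCoeff * p.eval (y k)) := by
  obtain ⟨z, hz, hpz⟩ := hp.exists_eq_prod
  have hlc := hp.leadingCoeff_ne_zero
  have heval : ∀ t, p.eval t = p.leadingCoeff * ∏ k ∈ Finset.range n, (t - z k) := by
    intro t; conv_lhs => rw [hpz]
    simp [eval_prod]
  have hz0 : ∀ i < n, p.eval (z i) = 0 := by
    intro i hi
    rw [heval, Finset.prod_eq_zero (Finset.mem_range.mpr hi) (sub_self _), mul_zero]
  have hex : ∀ k, ∃ y, k ∈ Set.Ioo 0 n →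
      y ∈ Set.Ioo (z k) (z (k - 1)) ∧ IsLocalExtr (fun x => p.eval x) y := by
    intro k
    by_cases hk : k ∈ Set.Ioo 0 n
    · have hlt : z k < z (k - 1) :=
        hz (a := k - 1) (b := k) (by have := hk.2; simp; omega) hk.2 (by have := hk.1; omega)
      obtain ⟨y, hy, hloc⟩ := exists_isLocalExtr_Ioo hlt p.continuous.continuousOn
        (by rw [hz0 k hk.2, hz0 (k - 1) (by have := hk.2; omega)])
      exact ⟨y, fun _ => ⟨hy, hloc⟩⟩
    · exact ⟨0, fun h => absurd h hk⟩
  choose y hy using hex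
  have hanti : StrictAntiOn y (Set.Ioo 0 n) := by
    intro a ha b hb hab
    have h1 := (hy a ha).1.1
    have h2 := (hy b hb).1.2
    have hb2 := hb.2
    have h3 := hz.antitoneOn (a := a) (b := b - 1) ha.2 (by simp; omega) (by omega)
    linarith
  refine ⟨y, ?_, hanti, fun k hk => ?_⟩
  · ext x
    constructor
    · intro hx
      have hder : ∀ x, IsLocalExtr (fun x => p.eval x) x → p.derivative.eval x = 0 :=
        fun x hx => hx.hasDerivAt_eq_zero (p.hasDerivAt x)
      obtain ⟨k, hk0, hk, rfl⟩ := exists_eq_of_derivative_eval_eq_zero (n := n) (by omega)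
        hp.natDegree_eq.le (by rwa [← hp.natDegree_eq]) hanti.injOn
        (fun k hk0 hk => hder _ (hy k ⟨hk0, hk⟩).2) (hder x hx)
      exact ⟨k, ⟨hk0, hk⟩, rfl⟩
    · rintro ⟨k, hk, rfl⟩
      exact (hy k hk).2
  · have hyk := (hy k hk).1
    have hkn := hk.2
    have h₁ : 0 < ∏ l ∈ Finset.range k, ((-1) * (y k - z l)) := by
      refine Finset.prod_pos fun l hl => ?_
      have hl := Finset.mem_range.mp hl
      have := hz.antitoneOn (a := l) (b := k - 1) (by simp; omega) (by simp; omega) (by omega)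
      linarith [hyk.2]
    rw [Finset.prod_mul_distrib, Finset.prod_const, Finset.card_range] at h₁
    have h₂ : 0 < ∏ l ∈ Finset.Ico k n, (y k - z l) := by
      refine Finset.prod_pos fun l hl => ?_
      have hl := Finset.mem_Ico.mp hl
      have := hz.antitoneOn (a := k) (b := l) hk.2 hl.2 hl.1
      linarith [hyk.1]
    rw [heval, ← Finset.prod_range_mul_prod_Ico _ hkn.le]
    have h3 : 0 < p.leadingCoeff ^ 2 := by positivity
    have := mul_pos h3 (mul_pos h₁ h₂)
    linarith

theorem zetaMin_le {p : ℝ[X]} {x : ℝ} (hx : x ∈ extremaSet p) : zetaMin p ≤ |p.eval x| :=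
  csInf_le ⟨0, by rintro _ ⟨y, -, rfl⟩; exact abs_nonneg _⟩ ⟨x, hx, rfl⟩

theorem IsRealRooted.zetaMin_pos {n : ℕ} (hn : 2 ≤ n) {p : ℝ[X]} (hp : IsRealRooted n p) :
    0 < zetaMin p := by
  obtain ⟨y, hy, -, hpos⟩ := hp.exists_extrema hn
  have hfin : ((fun y : ℝ => |p.eval y|) '' extremaSet p).Finite := by
    rw [hy]; exact ((Set.finite_Ioo 0 n).image _).image _
  have hne : ((fun y : ℝ => |p.eval y|) '' extremaSet p).Nonempty := by
    rw [hy]; exact ((Set.Nonempty.image y ⟨1, by simp; omega⟩).image _)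
  have hmem := hne.csInf_mem hfin
  rw [hy] at hmem
  obtain ⟨_, ⟨k, hk, rfl⟩, hval⟩ := hmem
  rw [zetaMin, hy, ← hval]
  refine abs_pos.mpr fun h0 => ?_
  have := hpos k hk
  rw [h0] at this
  simp at this

theorem extremaSet_comp_subset {q : ℝ[X]} {s r : ℝ} {x : ℝ} (hs : s ≠ 0)
    (hx : r * x ∈ extremaSet q) : x ∈ extremaSet (C s * q.comp (C r * X)) := by
  have h1 : IsLocalExtr (fun t => q.eval (r * t)) x := by
    have hc : Filter.Tendsto (fun t : ℝ => r * t) (nhds x) (nhds (r * x)) :=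
      (continuous_const.mul continuous_id).tendsto x
    exact IsExtrFilter.comp_tendsto hx hc
  have e : (fun t => (C s * q.comp (C r * X)).eval t) = fun t => s * q.eval (r * t) := by
    ext t; simp
  show IsLocalExtr _ x
  rw [e]
  rcases hs.lt_or_gt with hs | hs
  · exact h1.comp_antitone (g := fun t => s * t) fun a b hab =>
      mul_le_mul_of_nonpos_left hab hs.le
  · exact h1.comp_mono (g := fun t => s * t) fun a b hab => mul_le_mul_of_nonneg_left hab hs.le

theorem mem_extremaSet_comp_iff {q : ℝ[X]} {s r : ℝ} {x : ℝ} (hs : s ≠ 0) (hr : r ≠ 0) :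
    x ∈ extremaSet (C s * q.comp (C r * X)) ↔ r * x ∈ extremaSet q := by
  refine ⟨fun h => ?_, extremaSet_comp_subset hs⟩
  have h1 : r⁻¹ * (r * x) ∈ extremaSet (C s * q.comp (C r * X)) := by
    rwa [inv_mul_cancel_left₀ hr]
  have h2 := extremaSet_comp_subset (inv_ne_zero hs) h1
  have e : C s⁻¹ * (C s * q.comp (C r * X)).comp (C r⁻¹ * X) = q := by
    refine funext fun t => ?_
    simp [hs, hr]
  rwa [e] at h2

theorem extremaSet_chebyshev_comp {n : ℕ} (hn : 2 ≤ n) {s r : ℝ} (hs : s ≠ 0) (hr : r ≠ 0) :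
    extremaSet (C s * (T ℝ n).comp (C r * X)) = (fun k => r⁻¹ * node n k) '' Set.Ioo 0 n := by
  ext x
  rw [mem_extremaSet_comp_iff hs hr]
  refine (Chebyshev.isLocalExtr_T_real_iff hn (r * x)).trans ⟨?_, ?_⟩
  · rintro ⟨k, hk, hx⟩
    exact ⟨k, Finset.mem_Ioo.mp hk, by simp only [node]; rw [← hx, inv_mul_cancel_left₀ hr]⟩
  · rintro ⟨k, hk, rfl⟩
    exact ⟨k, Finset.mem_Ioo.mpr hk, by simp only [node]; rw [mul_inv_cancel_left₀ hr]⟩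

theorem exists_lt_one_le_eval {n : ℕ} (hn : 0 < n) {P : ℝ[X]} (hP : P.natDegree ≤ n)
    (hpos : 0 < P.coeff n) (M : ℝ) : ∃ x, M < x ∧ 1 ≤ P.eval x := by
  have hd : P.natDegree = n := natDegree_eq_of_le_of_coeff_ne_zero hP hpos.ne'
  have ht := P.tendsto_atTop_of_leadingCoeff_nonneg (natDegree_pos_iff_degree_pos.mp (by omega))
    (by rw [leadingCoeff, hd]; exact hpos.le)
  obtain ⟨x, hx1, hx2⟩ :=
    ((Filter.eventually_gt_atTop M).and (ht.eventually_ge_atTop 1)).exists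
  exact ⟨x, hx1, hx2⟩

/-- If the alternation is known at `n - 1` points, the two outermost alternation points exist
arbitrarily far out. -/
theorem exists_alternates {n : ℕ} (hn : 2 ≤ n) {P : ℝ[X]} (hP : P.natDegree ≤ n)
    (hc : P.coeff n = 2 ^ (n - 1)) {y : ℕ → ℝ} (hy : StrictAntiOn y (Set.Ioo 0 n))
    (hone : ∀ k ∈ Set.Ioo 0 n, 1 ≤ (-1) ^ k * P.eval (y k)) (M : ℝ) :
    ∃ y' : ℕ → ℝ, Alternates n P y' ∧ (∀ k ∈ Set.Ioo 0 n, y' k = y k) ∧ M < y' 0 ∧ y' n < -M := by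
  obtain ⟨e₀, he₀, he₀1⟩ := exists_lt_one_le_eval (by omega) hP (by rw [hc]; positivity)
    (max M (y 1))
  have hs : ((-1 : ℝ) ^ n) * (-1) ^ n = 1 := by rw [← mul_pow]; norm_num
  obtain ⟨eₙ, heₙ, heₙ1⟩ := exists_lt_one_le_eval (n := n)
    (P := C ((-1) ^ n) * P.comp (C 0 + C (-1) * X)) (by omega)
    (by
      refine (natDegree_C_mul_le _ _).trans (natDegree_comp_le.trans ?_)
      have : (C (0 : ℝ) + C (-1) * X).natDegree ≤ 1 := by compute_degree
      nlinarith)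
    (by
      rw [coeff_C_mul, coeff_comp_linear hP, hc]
      have e : (-1 : ℝ) ^ n * (2 ^ (n - 1) * (-1) ^ n) = 2 ^ (n - 1) := by
        linear_combination 2 ^ (n - 1) * hs
      rw [e]; positivity) (max M (-y (n - 1)))
  obtain ⟨he₀, he₀y⟩ := max_lt_iff.mp he₀
  obtain ⟨heₙ, heₙy⟩ := max_lt_iff.mp heₙ
  simp only [eval_mul, eval_C, eval_comp, eval_add, eval_X, zero_add, neg_one_mul] at heₙ1
  set y' : ℕ → ℝ := fun k => if k = 0 then e₀ else if k = n then -eₙ else y k with hy'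
  have hy0 : y' 0 = e₀ := by simp [hy']
  have hyn : y' n = -eₙ := by simp [hy']; omega
  have hym : ∀ k ∈ Set.Ioo 0 n, y' k = y k := by
    intro k hk
    have h0 := hk.1
    have hkn := hk.2
    simp only [hy']
    rw [if_neg (by omega), if_neg (by omega)]
  refine ⟨y', ⟨hP, hc, fun k hk => ?_, fun k hk => ?_⟩, hym, by rw [hy0]; exact he₀,
    by rw [hyn]; linarith⟩
  · rcases Nat.eq_zero_or_pos k with rfl | hk0
    · rw [hy0, hym _ ⟨by omega, by omega⟩]; exact he₀y
    · rw [hym k ⟨hk0, hk⟩]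
      rcases Nat.lt_or_ge (k + 1) n with hlt | hge
      · rw [hym _ ⟨by omega, hlt⟩]
        exact hy ⟨hk0, hk⟩ ⟨by omega, hlt⟩ (Nat.lt_succ_self k)
      · obtain rfl : n = k + 1 := by omega
        rw [hyn]; rw [Nat.add_sub_cancel] at heₙy; linarith
  · rcases Nat.eq_zero_or_pos k with rfl | hk0
    · rw [hy0]; simpa using he₀1
    · rcases hk.eq_or_lt with rfl | hk
      · rw [hyn]; exact heₙ1
      · rw [hym k ⟨hk0, hk⟩]; exact hone k ⟨hk0, hk⟩

/-! ### Comparison of the bands -/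

theorem scaleFactor_pos {n : ℕ} (hn : 2 ≤ n) {p : ℝ[X]} (hp : IsRealRooted n p) :
    0 < scaleFactor n p := by
  have := hp.zetaMin_pos hn
  have := abs_pos.mpr hp.leadingCoeff_ne_zero
  exact Real.rpow_pos_of_pos (by positivity) _

theorem scaleFactor_pow {n : ℕ} (hn : 2 ≤ n) {p : ℝ[X]} (hp : IsRealRooted n p) :
    scaleFactor n p ^ n = 2 * |p.leadingCoeff| / zetaMin p := by
  have := hp.zetaMin_pos hn
  rw [scaleFactor, one_div, Real.rpow_inv_natCast_pow (by positivity) (by omega)]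

/-- The passage from `P = (σ / ζ) * p` back to `p`, for all combinations of the sign `σ` of the
leading coefficient and the sign `s` of the slope of `P` on the lap. -/
theorem div_le_mul_and_mul_le_div_of_sign {A B ζ σ s T x y : ℝ} (hζ : 0 < ζ) (hσ : σ = 1 ∨ σ = -1)
    (hs : s = 1 ∨ s = -1) (hx : x ∈ Set.Icc A B) (hy : y ∈ Set.Icc A B)
    (hT : s * T ∈ Set.Icc (s * (σ / ζ * x)) (s * (σ / ζ * y))) :
    A / ζ ≤ σ * T ∧ σ * T ≤ B / ζ := by
  rw [le_div_iff₀ hζ, div_le_iff₀ hζ]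
  obtain ⟨h1, h2⟩ := hT
  have e : ∀ x, s * (σ / ζ * x) = s * σ * x / ζ := fun x => by ring
  rw [e, div_le_iff₀ hζ] at h1
  rw [e, le_div_iff₀ hζ] at h2
  obtain ⟨hx1, hx2⟩ := hx
  obtain ⟨hy1, hy2⟩ := hy
  rcases hσ with rfl | rfl <;> rcases hs with rfl | rfl <;> constructor <;> linarith

/-- Two points of a band of `p` are not further apart than the length of the corresponding band of
the comparison polynomial. -/
theorem edist_le_volume_band {n : ℕ} (hn : 2 ≤ n) {p : ℝ[X]} (hp : IsRealRooted n p) {a b : ℝ}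
    {i : ℕ} (hi : i < n) {u v : ℝ} (huv : u < v) (hu : u ∈ band p (i + 1) a b)
    (hv : v ∈ band p (i + 1) a b) (hu1 : |p.eval u| < zetaMin p) (hv1 : |p.eval v| < zetaMin p) :
    edist u v ≤ MeasureTheory.volume
      (band (C (Real.sign p.leadingCoeff) * rescaledChebyshev n (scaleFactor n p)) (i + 1)
        (a / zetaMin p) (b / zetaMin p)) := by
  have hζ := hp.zetaMin_pos hn
  have hc := scaleFactor_pos hn hp
  have hcn := scaleFactor_pow hn hp
  have hlc := hp.leadingCoeff_ne_zero
  obtain ⟨y, hext, hanti, hsign⟩ := hp.exists_extrema hn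
  set ζ := zetaMin p with hζdef
  set c := scaleFactor n p with hcdef
  set σ := Real.sign p.leadingCoeff with hσdef
  have hσ : σ = 1 ∨ σ = -1 := by
    rcases hlc.lt_or_gt with h | h
    · right; exact Real.sign_of_neg h
    · left; exact Real.sign_of_pos h
  have hσ0 : σ ≠ 0 := by rcases hσ with h | h <;> rw [h] <;> norm_num
  have hσabs : |σ| = 1 := by rcases hσ with h | h <;> rw [h] <;> simp
  have hσlc : σ * p.leadingCoeff = |p.leadingCoeff| := by
    rcases hlc.lt_or_gt with h | h
    · rw [hσdef, Real.sign_of_neg h, abs_of_neg h]; ring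
    · rw [hσdef, Real.sign_of_pos h, abs_of_pos h]; ring
  -- The normalised polynomial.
  set P : ℝ[X] := C (σ / ζ) * p.comp (C 0 + C (2 / c) * X) with hP
  have hPe : ∀ t, P.eval (c / 2 * t) = σ / ζ * p.eval t := by
    intro t
    have : 2 / c * (c / 2 * t) = t := by field_simp
    simp [hP, this]
  have hPd : P.natDegree ≤ n := by
    refine (natDegree_C_mul_le _ _).trans (natDegree_comp_le.trans ?_)
    have h1 : (C (0 : ℝ) + C (2 / c) * X).natDegree ≤ 1 := by compute_degree
    have := hp.natDegree_eq
    nlinarith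
  have hPc : P.coeff n = 2 ^ (n - 1) := by
    have h1 : p.coeff n = p.leadingCoeff := by rw [leadingCoeff, hp.natDegree_eq]
    have h2 := abs_pos.mpr hlc
    rw [hP, coeff_C_mul, coeff_comp_linear hp.natDegree_eq.le, h1, div_pow, hcn]
    obtain ⟨m, rfl⟩ : ∃ m, n = m + 1 := ⟨n - 1, by omega⟩
    rw [Nat.add_sub_cancel, ← hσlc] at *
    rw [pow_succ]
    field_simp
  have habs : ∀ t, |P.eval (c / 2 * t)| = |p.eval t| / ζ := by
    intro t
    rw [hPe, abs_mul, abs_div, hσabs, abs_of_pos hζ]; ring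
  have hyanti : StrictAntiOn (fun k => c / 2 * y k) (Set.Ioo 0 n) := by
    intro k hk l hl hkl
    have := hanti hk hl hkl
    simp only
    gcongr
  have hone : ∀ k ∈ Set.Ioo 0 n, 1 ≤ (-1) ^ k * P.eval (c / 2 * y k) := by
    intro k hk
    have h1 : 0 < (-1) ^ k * P.eval (c / 2 * y k) := by
      have h2 := hsign k hk
      have h3 := abs_pos.mpr hlc
      have h4 : p.leadingCoeff = |p.leadingCoeff| * σ := by
        rw [← hσlc]; rcases hσ with h | h <;> rw [h] <;> ring
      rw [h4] at h2
      have h5 : 0 < (-1) ^ k * (σ * p.eval (y k)) := by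
        refine pos_of_mul_pos_left (b := |p.leadingCoeff|) ?_ h3.le
        linarith
      rw [hPe]
      have e : (-1) ^ k * (σ / ζ * p.eval (y k)) = (-1) ^ k * (σ * p.eval (y k)) / ζ := by ring
      rw [e]; positivity
    rw [← abs_of_pos h1, abs_mul, abs_neg_one_pow, one_mul, habs, one_le_div hζ]
    exact zetaMin_le (hext ▸ ⟨k, hk, rfl⟩)
  obtain ⟨y', halt, hy', hM0, hMn⟩ :=
    exists_alternates hn hPd hPc hyanti hone (max |c / 2 * u| |c / 2 * v|)
  obtain ⟨hulap, hua, hub⟩ := hu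
  obtain ⟨hvlap, hva, hvb⟩ := hv
  rw [mem_lap_succ_iff hi hext hanti] at hulap hvlap
  set s : ℝ := (-1) ^ i with hsdef
  have hs : s = 1 ∨ s = -1 := neg_one_pow_eq_or ℝ i
  have hbound : ∀ t, |p.eval t| < ζ → |s * P.eval (c / 2 * t)| < 1 := by
    intro t ht
    rw [abs_mul, hsdef, abs_neg_one_pow, one_mul, habs, div_lt_one hζ]; exact ht
  have hαb := abs_lt.mp (hbound u hu1)
  have hβb := abs_lt.mp (hbound v hv1)
  have hcuv : c / 2 * u < c / 2 * v := by gcongr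
  have hseg : IsSegment n P y' i (s * P.eval (c / 2 * u)) (s * P.eval (c / 2 * v))
      (c / 2 * u) (c / 2 * v) := by
    refine ⟨halt, ?_, hcuv.le, ?_, le_rfl, le_rfl⟩
    · rcases Nat.lt_or_ge (i + 1) n with hlt | hge
      · rw [hy' _ ⟨by omega, hlt⟩]
        have := hulap.1 hlt
        gcongr
      · obtain rfl : n = i + 1 := by omega
        have h1 := le_max_left |c / 2 * u| |c / 2 * v|
        have h2 := neg_abs_le (c / 2 * u)
        linarith
    · rcases Nat.eq_zero_or_pos i with rfl | hi0
      · have h1 := le_max_right |c / 2 * u| |c / 2 * v|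
        have h2 := le_abs_self (c / 2 * v)
        linarith
      · rw [hy' _ ⟨hi0, hi⟩]
        have := hvlap.2 hi0
        gcongr
  have hαβ : s * P.eval (c / 2 * u) ≤ s * P.eval (c / 2 * v) := by
    by_contra! hcon
    exact halt.not_le_eval_of_lt hi (hseg.lt_left hi hαb.1) hcuv (hseg.right_lt hi hβb.2)
      hβb.1 hβb.2 hcon.le le_rfl
  obtain ⟨u', v', hlen, hT⟩ := hseg.exists_chebyshev_segment hn hi hαb.1 hαβ hβb.2 hcuv
  have hsub : Set.Icc (2 / c * u') (2 / c * v') ⊆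
      band (C σ * rescaledChebyshev n c) (i + 1) (a / ζ) (b / ζ) := by
    intro x hx
    have hx' : c / 2 * x ∈ Set.Icc u' v' := by
      have e : ∀ t, c / 2 * (2 / c * t) = t := fun t => by field_simp
      constructor
      · rw [← e u']; gcongr; exact hx.1
      · rw [← e v']; gcongr; exact hx.2
    obtain ⟨h1, h2, h3⟩ := hT _ hx'
    have hnode : StrictAntiOn (fun k => (c / 2)⁻¹ * node n k) (Set.Ioo 0 n) := by
      intro k hk l hl hkl
      have := Chebyshev.node_lt hl.2.le hkl
      simp only
      gcongr
    refine ⟨?_, ?_⟩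
    · rw [rescaledChebyshev, mem_lap_succ_iff hi
        (extremaSet_chebyshev_comp hn hσ0 (by positivity)) hnode]
      exact ⟨fun h => (inv_mul_le_iff₀ (by positivity)).mpr (h1 h),
        fun h => (le_inv_mul_iff₀ (by positivity)).mpr (h2 h)⟩
    · rw [hPe, hPe] at h3
      have := div_le_mul_and_mul_le_div_of_sign hζ hσ hs ⟨hua, hub⟩ ⟨hva, hvb⟩ h3
      simpa [rescaledChebyshev] using this
  refine le_trans ?_ (MeasureTheory.measure_mono hsub)
  rw [Real.volume_Icc, edist_dist, Real.dist_eq, abs_sub_comm, abs_of_pos (sub_pos.mpr huv)]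
  refine ENNReal.ofReal_le_ofReal ?_
  have e : v - u = 2 / c * (c / 2 * v - c / 2 * u) := by field_simp
  rw [e, ← mul_sub (2 / c) v' u']
  gcongr

theorem theorem6p4 (n : ℕ) (hn : 2 ≤ n) (p : Polynomial ℝ) (hp : IsRealRooted n p)
    (a b : ℝ) (ha : -zetaMin p ≤ a) (hab : a < b) (hb : b ≤ zetaMin p)
    (j : ℕ) (hj1 : 1 ≤ j) (hjn : j ≤ n) :
    MeasureTheory.volume (band p j a b) ≤
      MeasureTheory.volume
        (band (Polynomial.C (Real.sign p.leadingCoeff) *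
            rescaledChebyshev n (scaleFactor n p)) j (a / zetaMin p) (b / zetaMin p)) := by
  obtain ⟨i, rfl⟩ : ∃ i, j = i + 1 := ⟨j - 1, by omega⟩
  have hi : i < n := hjn
  -- The core comparison needs levels inside `(-ζ, ζ)`; only finitely many points are lost.
  set E : Set ℝ := {x ∈ band p (i + 1) a b | |p.eval x| < zetaMin p} with hE
  have hfin : ∀ r : ℝ, MeasureTheory.volume {x : ℝ | p.eval x = r} = 0 := by
    intro r
    refine Set.Finite.measure_zero ?_ _
    have hne : p - C r ≠ 0 := by
      intro h0
      have h1 := natDegree_sub_C (p := p) (a := r)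
      rw [h0, natDegree_zero, hp.natDegree_eq] at h1
      omega
    refine (p - C r).roots.toFinset.finite_toSet.subset fun x hx => ?_
    have hx : p.eval x = r := hx
    simp [mem_roots hne, hx]
  have hsub : band p (i + 1) a b ⊆
      E ∪ ({x | p.eval x = zetaMin p} ∪ {x | p.eval x = -zetaMin p}) := by
    intro x hx
    by_cases h1 : p.eval x = zetaMin p
    · exact Or.inr (Or.inl h1)
    by_cases h2 : p.eval x = -zetaMin p
    · exact Or.inr (Or.inr h2)
    · exact Or.inl ⟨hx, abs_lt.mpr ⟨lt_of_le_of_ne (ha.trans hx.2.1) (Ne.symm h2),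
        lt_of_le_of_ne (hx.2.2.trans hb) h1⟩⟩
  calc MeasureTheory.volume (band p (i + 1) a b)
      ≤ MeasureTheory.volume E := by
        refine (MeasureTheory.measure_mono hsub).trans
          ((MeasureTheory.measure_union_le _ _).trans ?_)
        have := MeasureTheory.measure_union_null (hfin (zetaMin p)) (hfin (-zetaMin p))
        rw [this, add_zero]
    _ ≤ Metric.ediam E := Real.volume_le_diam E
    _ ≤ _ := by
        refine Metric.ediam_le fun u hu v hv => ?_
        rcases lt_trichotomy u v with huv | rfl | huv
        · exact edist_le_volume_band hn hp hi huv hu.1 hv.1 hu.2 hv.2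
        · simp
        · rw [edist_comm]
          exact edist_le_volume_band hn hp hi huv hv.1 hu.1 hv.2 hu.2
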